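/- **Setting.** Let $P$ be a probability measure on a Polish space $\mathcal X$. Let $X_1,X_2,\dots$ be i.i.d. with law $P$ and, independently of them, let $G_1$ be a standard Gumbel variable (location $0$, scale $1$) and, for $i\ge 1$, let $G_{i+1}$ given $G_1,\dots,G_i$ be a standard Gumbel variable truncated to $(-\infty,G_i)$. For a target $Q\ll P$ and a measurable $\widetilde r\propto dQ/dP$ (positive finite proportionality constant), the *score* of $n\ge 1$ is $s_n=\ln\widetilde r(X_n)+G_n$ with $\ln 0=-\infty$. *A\* coding* returns $N=\arg\max_{n\ge 1}s_n$. *Depth-limited A\* coding with budget $k\ge 1$* starts with $(N',L)=(0,-\infty)$ and, for $i=1,\dots,k$, sets $(N',L)\leftarrow(i,s_i)$ whenever $L<s_i$; so it returns $N'=\arg\max_{1\le n\le k}s_n$. (Ties are broken in favour of the smallest index. If $s_1=\dots=s_k=-\infty$, the loop returns $0$; the $\arg\max$ convention gives $1$. Below, $N'\in\{1,\dots,k\}$ denotes the $\arg\max$ and $N'_0\in\{0,\dots,k\}$ the loop's raw output.) **Claim 1 (fixed target).** For all $Q\ll P$, $\widetilde r\propto dQ/dP$ and $k\ge 1$: almost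 surely the maximum defining $N$ is attained and $N'\le N$. Consequently $\mathbb E[\log_2 N']\le\mathbb E[\log_2 N]$ (in $[0,\infty]$). **Claim 2 (channel simulation).** Let $(x,y)$ have joint law $P_{x,y}$ with $P_x=P$, where $x$ takes values in $\mathcal X$ and $y$ in an arbitrary measurable space, and suppose that the mutual information $I=I(x;y)$, in bits, is finite. Let $y\sim P_y$ be independent of $(X_i)_i,(G_i)_i$, and run both procedures with the target $Q=P_{x\mid y}$ and an unnormalised density $\widetilde r_y\propto dP_{x\mid y}/dP$ that is jointly measurable in $(y,x)$. Then again, almost surely, the maximum defining $N$ is attained and $N'\le N$, and $\mathbb E[\log_2 N']\le\mathbb E[\log_2 N]$. Let $\zeta(n\mid\lambda)=n^{-\lambda}/\sum_{m\ge1}m^{-\lambda}$ with $$\lambda=1+\frac{1}{I+e^{-1}\log_2 e+1}.$$ Then the entropy of $N'$ and its expected ideal codelength under $\zeta(\cdot\mid\lambda)$, both in bits, satisfy $$H[N']\ \le\ \mathbb E\big[-\log_2\zeta(N'\mid\lambda)\big]\ <\ I+\log_2(I+1)+4,$$ and also $H[N'_0]<I+\log_2(I+1)+4$. In particular $N'$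 can be encoded at the optimal rate $I+\log_2(I+1)+O(1)$: there is a binary prefix code $c$ on $\{1,2,\dots\}$ whose codeword lengths are $\lceil-\log_2\zeta(n\mid\lambda)\rceil$, $n\ge1$, and for which $\mathbb E[\,|c(N')|\,]<I+\log_2(I+1)+5$. -/

import Mathlib

open MeasureTheory ProbabilityTheory InformationTheory
open scoped ENNReal

noncomputable section

/-- The standard Gumbel distribution (location `0`, scale `1`), with density
`x ↦ exp (-(x + exp (-x)))`. -/
def gumbelMeasure : Measure ℝ :=
  volume.withDensity fun x => ENNReal.ofReal (Real.exp (-(x + Real.exp (-x))))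

/-- The randomness used by A* coding. All sequences are indexed from `0`, so that `X i` and `G i`
are the `(i + 1)`-st proposal sample and the `(i + 1)`-st Gumbel variable.

* `X 0, X 1, …` are i.i.d. with law `P`;
* `G 0` is a standard Gumbel variable and, given `G 0, …, G i`, the variable `G (i + 1)` is a
  standard Gumbel variable truncated to `(-∞, G i)`;
* the two sequences are independent of each other. -/
structure IsSharedRandomness {Ω 𝓧 : Type*} [MeasurableSpace Ω] [MeasurableSpace 𝓧]
    (μ : Measure Ω) [IsProbabilityMeasure μ] (P : Measure 𝓧)
    (X : ℕ → Ω → 𝓧) (G : ℕ → Ω → ℝ) : Prop where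
  measurable_X : ∀ i, Measurable (X i)
  law_X : ∀ i, μ.map (X i) = P
  indep_X : iIndepFun X μ
  measurable_G : ∀ i, Measurable (G i)
  law_G_zero : μ.map (G 0) = gumbelMeasure
  law_G_succ : ∀ i : ℕ, ∀ᵐ h ∂(μ.map fun ω (j : Fin (i + 1)) => G j ω),
    condDistrib (G (i + 1)) (fun ω (j : Fin (i + 1)) => G j ω) μ h
      = ProbabilityTheory.cond gumbelMeasure (Set.Iio (h (Fin.last i)))
  indep_XG : IndepFun (fun ω i => X i ω) (fun ω i => G i ω) μ

/-- `r` is an unnormalised version of the Radon–Nikodym derivative `dQ/dP`: it agrees `P`-almost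
everywhere with a positive finite multiple of it. -/
def IsUnnormalizedDensity {𝓧 : Type*} [MeasurableSpace 𝓧] (r : 𝓧 → ℝ≥0∞) (Q P : Measure 𝓧) :
    Prop :=
  ∃ c : ℝ≥0∞, c ≠ 0 ∧ c ≠ ∞ ∧ r =ᵐ[P] fun x => c * Q.rnDeriv P x

/-- The score `ln r(x i) + g i` of the candidate with index `i + 1`. It takes values in the
extended reals, with `ln 0 = -∞`. -/
def aStarScore {𝓧 : Type*} (r : 𝓧 → ℝ≥0∞) (x : ℕ → 𝓧) (g : ℕ → ℝ) (i : ℕ) : EReal :=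
  ENNReal.log (r (x i)) + (g i : EReal)

/-- The indices (counted from `1`) at which the score sequence attains its maximum over all
candidates. -/
def argmaxSet (s : ℕ → EReal) : Set ℕ := {n | ∃ i, n = i + 1 ∧ ∀ j, s j ≤ s i}

/-- The index `N` returned by A* coding: the (first) maximiser of the score over all candidates. -/
def aStarIndex (s : ℕ → EReal) : ℕ := sInf (argmaxSet s)

/-- The loop of depth-limited A* coding: the values of the variables `(N, L)` after the given number
of iterations, started at `N = 0`, `L = -∞`. -/
def aStarLoop (s : ℕ → EReal) : ℕ → ℕ × EReal
  | 0 => (0, ⊥)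
  | i + 1 => if (aStarLoop s i).2 < s i then (i + 1, s i) else aStarLoop s i

/-- The value of the variable `N` when depth-limited A* coding with budget `k` ends. It is `0` if
and only if the scores of all the `k` candidates equal `-∞`. -/
def loopIndex (s : ℕ → EReal) (k : ℕ) : ℕ := (aStarLoop s k).1

/-- The index `N'` of depth-limited A* coding with budget `k`, i.e. the (first) maximiser of the
score over the first `k` candidates, see `depthLimitedIndex_isLeast`. This is the index computed by
the loop, except that index `1` is returned if all scores equal `-∞`. -/
def depthLimitedIndex (s : ℕ → EReal) (k : ℕ) : ℕ := max 1 (loopIndex s k)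

lemma aStarLoop_spec (s : ℕ → EReal) (k : ℕ) :
    ((aStarLoop s k = (0, ⊥)) ∧ ∀ j < k, s j = ⊥) ∨
    ∃ i < k, aStarLoop s k = (i + 1, s i) ∧ (∀ j < k, s j ≤ s i) ∧ ∀ j < i, s j < s i := by
  induction k with
  | zero => left; simp [aStarLoop]
  | succ k ih =>
    rcases ih with ⟨h0, hb⟩ | ⟨i, hik, h0, hle, hlt⟩
    · by_cases hk : s k = ⊥
      · left
        refine ⟨by simp [aStarLoop, h0, hk], fun j hj => ?_⟩
        rcases Nat.lt_succ_iff_lt_or_eq.1 hj with h | rfl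
        exacts [hb j h, hk]
      · right
        have hpos : ⊥ < s k := bot_lt_iff_ne_bot.2 hk
        refine ⟨k, by omega, by simp [aStarLoop, h0, hpos], fun j hj => ?_,
          fun j hj => by rw [hb j hj]; exact hpos⟩
        rcases Nat.lt_succ_iff_lt_or_eq.1 hj with h | rfl
        exacts [by rw [hb j h]; exact bot_le, le_rfl]
    · right
      by_cases hk : s i < s k
      · refine ⟨k, by omega, by simp [aStarLoop, h0, hk], fun j hj => ?_,
          fun j hj => (hle j hj).trans_lt hk⟩
        rcases Nat.lt_succ_iff_lt_or_eq.1 hj with h | rfl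
        exacts [(hle j h).trans hk.le, le_rfl]
      · refine ⟨i, by omega, by simp [aStarLoop, h0, hk], fun j hj => ?_, hlt⟩
        rcases Nat.lt_succ_iff_lt_or_eq.1 hj with h | rfl
        exacts [hle j h, not_lt.1 hk]

/-- `depthLimitedIndex s k` is the least maximiser of the score over the indices `1, …, k`. -/
lemma depthLimitedIndex_isLeast (s : ℕ → EReal) {k : ℕ} (hk : 1 ≤ k) :
    IsLeast {n | ∃ i < k, n = i + 1 ∧ ∀ j < k, s j ≤ s i} (depthLimitedIndex s k) := by
  rcases aStarLoop_spec s k with ⟨h0, hb⟩ | ⟨i, hik, h0, hle, hlt⟩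
  · have : depthLimitedIndex s k = 1 := by simp [depthLimitedIndex, loopIndex, h0]
    rw [this]
    refine ⟨⟨0, by omega, rfl, fun j hj => by rw [hb j hj]; exact bot_le⟩, ?_⟩
    rintro n ⟨i, -, rfl, -⟩
    omega
  · have : depthLimitedIndex s k = i + 1 := by simp [depthLimitedIndex, loopIndex, h0]
    rw [this]
    refine ⟨⟨i, hik, rfl, hle⟩, ?_⟩
    rintro n ⟨m, -, rfl, hm⟩
    by_contra hcon
    exact absurd (hm i hik) (not_le.2 (hlt m (by omega)))

/-- The expectation `E[log₂ N]` of an index `N` with values in `{1, 2, …}`. -/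
def expLogIndex {Ω : Type*} [MeasurableSpace Ω] (μ : Measure Ω) (N : Ω → ℕ) : ℝ≥0∞ :=
  ∫⁻ ω, ENNReal.ofReal (Real.logb 2 (N ω)) ∂μ

/-- The Shannon entropy, in bits, of a probability distribution on `ℕ`. -/
def entropyBits (ν : Measure ℕ) : ℝ≥0∞ :=
  ∑' n : ℕ, ENNReal.ofReal (Real.negMulLog (ν.real {n}) / Real.log 2)

/-- The mutual information, in bits, of a pair of random variables with joint law `π`. -/
def mutualInfoBits {𝓧 𝓨 : Type*} [MeasurableSpace 𝓧] [MeasurableSpace 𝓨]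
    (π : Measure (𝓨 × 𝓧)) : ℝ :=
  (klDiv π (π.fst.prod π.snd)).toReal / Real.log 2

/-- The probability mass function `ζ(n | lam) ∝ n ^ (-lam)` on `{1, 2, …}`, for `lam > 1`. -/
def zetaMass (lam : ℝ) (n : ℕ) : ℝ :=
  (n : ℝ) ^ (-lam) / ∑' m : ℕ, ((m : ℝ) + 1) ^ (-lam)

/-- The exponent `1 + 1 / (I + e⁻¹ log₂ e + 1)`. -/
def zetaExponent (I : ℝ) : ℝ :=
  1 + 1 / (I + Real.exp (-1) * Real.logb 2 (Real.exp 1) + 1)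

/-- The expected ideal codelength `E[-log₂ ζ(N | lam)]`, in bits, when an index `N` with values in
`{1, 2, …}` is encoded with the distribution `ζ(· | lam)`. -/
def zetaCodelength {Ω : Type*} [MeasurableSpace Ω] (μ : Measure Ω) (lam : ℝ) (N : Ω → ℕ) : ℝ≥0∞ :=
  ∫⁻ ω, ENNReal.ofReal (-Real.logb 2 (zetaMass lam (N ω))) ∂μ

/-- `c` is a binary prefix code for the positive integers that is matched to `ζ(· | lam)`: the
codeword of `n` has `⌈-log₂ ζ(n | lam)⌉` bits. -/
structure IsZetaCode (lam : ℝ) (c : ℕ → List Bool) : Prop where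
  prefixFree : ∀ m n : ℕ, 1 ≤ m → 1 ≤ n → c m <+: c n → m = n
  length_eq : ∀ n : ℕ, 1 ≤ n → (c n).length = ⌈-Real.logb 2 (zetaMass lam n)⌉₊

end

/-! ### Scores and their maximisers -/

/-! The inequality `N' ≤ N` is combinatorial: either the global maximiser lies within the budget and
competes there, or it exceeds every index in the budget. What needs probability is that the maximum
is attained, and that `E[log₂ N'] ≤ I + 1`.

Put `T n = exp (-G n)`. A Gumbel variable becomes a standard exponential, and truncation becomes
memorylessness, so the pairs `(T n, X n)` form a Poisson process on `(0, ∞)` with independent marks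
of law `P`. The score is maximal where `T n / r (X n)` is minimal. For integrable `r`, only finitely
many points exceed any given positive level of `r (X n) / T n`, because their expected number is
finite (`tsum_lintegral_markedPoint`); hence the maximum is attained (`ae_exists_isMax`).

Normalise `∫ r dP = 1`. A point `(t, x)` with `r x > 0` is never beaten with probability `exp (-t /
r x)`, and given this the number of earlier points is Poisson with mean at most `t`. Integrating
over `t` bounds the expectation of `a (X n) + n * d (X n)` at the maximiser by `∫ (a r + d r²) dP`
(`lintegral_tsum_isMaxEvent_le`). The Poisson computation is done by hand: integrating out one point
at a time is an operator `stepOp`, whose iterates have the closed form `acceptedWeight`.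

The tangent to `log` at `1 + r (X n)` majorises `log (n + 1)` by an expression affine in `n`, which
gives `E[log N] ≤ ∫ r log (1 + r) dP`. A second tangent bounds this by `klDiv Q P + log 2`
(`lintegral_log_le_of_isMaxEvent`), and averaging over `y` turns the divergence into mutual
information (`lintegral_klDiv_condKernel`).

The codelength under the zeta distribution is affine in `log₂ N'`, and the normalising sum is at
most `1 + 1 / (s - 1)`, so the rate follows by arithmetic. Gibbs' inequality gives the entropy
bound, and Kraft's construction gives the code. -/

lemma aStarScore_eq_log {𝓧 : Type*} (r : 𝓧 → ℝ≥0∞) (x : ℕ → 𝓧) (g : ℕ → ℝ) (i : ℕ) :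
    aStarScore r x g i = ENNReal.log (r (x i) * ENNReal.ofReal (Real.exp (g i))) := by
  rw [aStarScore, ENNReal.log_mul_add, ENNReal.log_ofReal_of_pos (Real.exp_pos _), Real.log_exp]

lemma ENNReal.mul_ofReal_exp_le_iff (a b : ℝ≥0∞) (g h : ℝ) :
    a * ENNReal.ofReal (Real.exp g) ≤ b * ENNReal.ofReal (Real.exp h) ↔
      a * ENNReal.ofReal (Real.exp (-h)) ≤ b * ENNReal.ofReal (Real.exp (-g)) := by
  have key : ∀ (a b : ℝ≥0∞) (g h : ℝ),
      a * ENNReal.ofReal (Real.exp g) ≤ b * ENNReal.ofReal (Real.exp h) →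
      a * ENNReal.ofReal (Real.exp (-h)) ≤ b * ENNReal.ofReal (Real.exp (-g)) := by
    intro a b g h hle
    have h1 := mul_le_mul_left hle (ENNReal.ofReal (Real.exp (-g - h)))
    rw [mul_assoc, mul_assoc, ← ENNReal.ofReal_mul (Real.exp_pos _).le,
      ← ENNReal.ofReal_mul (Real.exp_pos _).le, ← Real.exp_add, ← Real.exp_add] at h1
    convert h1 using 4 <;> ring
  refine ⟨key a b g h, fun hle => ?_⟩
  simpa using key a b (-h) (-g) hle

/-- Maximising the score means minimising `exp (-g i) / r (x i)`, a race between arrival times. The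
cross-multiplied form stays correct when `r` takes the values `0` or `∞`. -/
lemma aStarScore_le_iff {𝓧 : Type*} (r : 𝓧 → ℝ≥0∞) (x : ℕ → 𝓧) (g : ℕ → ℝ) (i j : ℕ) :
    aStarScore r x g j ≤ aStarScore r x g i ↔
      r (x j) * ENNReal.ofReal (Real.exp (-g i)) ≤ r (x i) * ENNReal.ofReal (Real.exp (-g j)) := by
  rw [aStarScore_eq_log, aStarScore_eq_log, ENNReal.log_le_log_iff,
    ENNReal.mul_ofReal_exp_le_iff]

lemma aStarIndex_mem {s : ℕ → EReal} (h : ∃ i, ∀ j, s j ≤ s i) : aStarIndex s ∈ argmaxSet s := by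
  obtain ⟨i, hi⟩ := h
  exact Nat.sInf_mem (s := argmaxSet s) ⟨i + 1, i, rfl, hi⟩

/-- A global maximiser inside the budget is also a maximiser there, so the least one cannot exceed
it; a global maximiser outside the budget is larger than every index inside. -/
lemma depthLimitedIndex_le_of_mem {s : ℕ → EReal} {k n : ℕ} (hk : 1 ≤ k) (hn : n ∈ argmaxSet s) :
    depthLimitedIndex s k ≤ n := by
  obtain ⟨i, rfl, hi⟩ := hn
  have h := depthLimitedIndex_isLeast s hk
  by_cases hik : i < k
  · exact h.2 ⟨i, hik, rfl, fun j _ => hi j⟩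
  · obtain ⟨m, hm, hm', -⟩ := h.1
    omega

lemma one_le_depthLimitedIndex (s : ℕ → EReal) (k : ℕ) : 1 ≤ depthLimitedIndex s k :=
  le_max_left _ _

/-- A sequence in `[0, ∞]` with only finitely many terms above each positive level attains its
maximum. -/
lemma exists_forall_le_of_finite_lt {v : ℕ → ℝ≥0∞}
    (h : ∀ m : ℕ, {n | ((m : ℝ≥0∞) + 1)⁻¹ < v n}.Finite) : ∃ i, ∀ j, v j ≤ v i := by
  by_cases h0 : ∀ j, v j = 0
  · exact ⟨0, fun j => by simp [h0]⟩
  · push Not at h0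
    obtain ⟨j₀, hj₀⟩ := h0
    obtain ⟨m, hm⟩ := ENNReal.exists_inv_nat_lt hj₀
    have hlt : ((m : ℝ≥0∞) + 1)⁻¹ < v j₀ :=
      lt_of_le_of_lt (ENNReal.inv_le_inv.2 le_self_add) hm
    obtain ⟨i, hi, hmax⟩ := Set.exists_max_image _ v (h m) ⟨j₀, hlt⟩
    refine ⟨i, fun j => ?_⟩
    by_cases hj : ((m : ℝ≥0∞) + 1)⁻¹ < v j
    · exact hmax j hj
    · exact (not_lt.1 hj).trans (le_of_lt hi)

section Measurability

variable {Ω 𝓧 : Type*} [MeasurableSpace Ω] [MeasurableSpace 𝓧]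

lemma measurable_aStarScore {r : Ω → 𝓧 → ℝ≥0∞} (hr : Measurable (Function.uncurry r))
    {x : ℕ → Ω → 𝓧} (hx : ∀ i, Measurable (x i)) {g : ℕ → Ω → ℝ} (hg : ∀ i, Measurable (g i))
    (i : ℕ) : Measurable fun ω => aStarScore (r ω) (fun i => x i ω) (fun i => g i ω) i := by
  simp_rw [aStarScore_eq_log]
  have h1 : Measurable fun ω => r ω (x i ω) := hr.comp (measurable_id.prodMk (hx i))
  have h2 : Measurable fun ω => ENNReal.ofReal (Real.exp (g i ω)) := by fun_prop
  exact ENNReal.measurable_log.comp (h1.mul h2)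

lemma measurable_aStarLoop {s : Ω → ℕ → EReal} (hs : ∀ i, Measurable fun ω => s ω i) (k : ℕ) :
    Measurable fun ω => aStarLoop (s ω) k := by
  induction k with
  | zero => exact measurable_const
  | succ k ih =>
    simp only [aStarLoop]
    exact Measurable.ite (measurableSet_lt ih.snd (hs k)) (measurable_const.prodMk (hs k)) ih

lemma measurable_loopIndex {s : Ω → ℕ → EReal} (hs : ∀ i, Measurable fun ω => s ω i) (k : ℕ) :
    Measurable fun ω => loopIndex (s ω) k := (measurable_aStarLoop hs k).fst

lemma measurable_depthLimitedIndex {s : Ω → ℕ → EReal} (hs : ∀ i, Measurable fun ω => s ω i)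
    (k : ℕ) : Measurable fun ω => depthLimitedIndex (s ω) k :=
  measurable_const.max (measurable_loopIndex hs k)

lemma measurableSet_exists_isMax {s : Ω → ℕ → EReal} (hs : ∀ i, Measurable fun ω => s ω i) :
    MeasurableSet {ω | ∃ i, ∀ j, s ω j ≤ s ω i} := by
  simp only [Set.ofPred_exists, Set.ofPred_forall]
  exact .iUnion fun i => .iInter fun j => measurableSet_le (hs j) (hs i)

end Measurability

/-! ### Exponential waiting times -/

/-- The expectation of `φ (s + E)`, where `E` is a standard exponential variable. -/
noncomputable def expTail (s : ℝ) (φ : ℝ → ℝ≥0∞) : ℝ≥0∞ :=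
  ∫⁻ v in Set.Ioi s, ENNReal.ofReal (Real.exp (-(v - s))) * φ v

lemma expTail_eq_lintegral_indicator (s : ℝ) (φ : ℝ → ℝ≥0∞) :
    expTail s φ
      = ∫⁻ v, (Set.Ioi s).indicator (fun v => ENNReal.ofReal (Real.exp (-(v - s))) * φ v) v := by
  rw [expTail, lintegral_indicator measurableSet_Ioi]

lemma measurable_expTail {α : Type*} [MeasurableSpace α] {s : α → ℝ} {φ : α → ℝ → ℝ≥0∞}
    (hs : Measurable s) (hφ : Measurable (Function.uncurry φ)) :
    Measurable fun a => expTail (s a) (φ a) := by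
  simp_rw [expTail_eq_lintegral_indicator]
  refine Measurable.lintegral_prod_right' (f := fun p : α × ℝ => (Set.Ioi (s p.1)).indicator
    (fun v => ENNReal.ofReal (Real.exp (-(v - s p.1))) * φ p.1 v) p.2) ?_
  have hm : MeasurableSet {p : α × ℝ | s p.1 < p.2} :=
    measurableSet_lt (hs.comp measurable_fst) measurable_snd
  have : (fun p : α × ℝ => (Set.Ioi (s p.1)).indicator
      (fun v => ENNReal.ofReal (Real.exp (-(v - s p.1))) * φ p.1 v) p.2)
      = {p : α × ℝ | s p.1 < p.2}.indicator
        (fun p => ENNReal.ofReal (Real.exp (-(p.2 - s p.1))) * Function.uncurry φ p) := by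
    ext p
    simp only [Set.indicator, Set.mem_Ioi, Set.mem_ofPred_eq, Function.uncurry]
  rw [this]
  refine Measurable.indicator ?_ hm
  have : Measurable fun p : α × ℝ => s p.1 := hs.comp measurable_fst
  exact (by fun_prop : Measurable fun p : α × ℝ =>
    ENNReal.ofReal (Real.exp (-(p.2 - s p.1)))).mul hφ

lemma expTail_const_mul (s : ℝ) (c : ℝ≥0∞) {φ : ℝ → ℝ≥0∞} (hφ : Measurable φ) :
    expTail s (fun v => c * φ v) = c * expTail s φ := by
  rw [expTail, expTail, ← lintegral_const_mul _ (by fun_prop)]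
  exact lintegral_congr fun v => by ring

lemma lintegral_Ioi_exp_neg (s : ℝ) :
    ∫⁻ v in Set.Ioi s, ENNReal.ofReal (Real.exp (-v)) = ENNReal.ofReal (Real.exp (-s)) := by
  rw [← ofReal_integral_eq_lintegral_ofReal (integrableOn_exp_neg_Ioi s)
    (ae_of_all _ fun v => (Real.exp_pos _).le), integral_exp_neg_Ioi]

lemma expTail_eq (s : ℝ) (φ : ℝ → ℝ≥0∞) : expTail s φ
    = ENNReal.ofReal (Real.exp s) * ∫⁻ v in Set.Ioi s, ENNReal.ofReal (Real.exp (-v)) * φ v := by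
  rw [← lintegral_const_mul' _ _ ENNReal.ofReal_ne_top]
  refine lintegral_congr fun v => ?_
  rw [← mul_assoc, ← ENNReal.ofReal_mul (Real.exp_pos _).le, ← Real.exp_add]
  ring_nf

/-- Substituting `v = exp (-g)`, the factor `exp (-g)` of the Gumbel density is the Jacobian and
what remains is `exp (-v)`: the image law is standard exponential. -/
lemma setLIntegral_gumbelMeasure {s : Set ℝ} (hs : MeasurableSet s) {φ : ℝ → ℝ≥0∞}
    (hφ : Measurable φ) :
    ∫⁻ g in s, φ (Real.exp (-g)) ∂gumbelMeasure
      = ∫⁻ v in (fun g => Real.exp (-g)) '' s, ENNReal.ofReal (Real.exp (-v)) * φ v := by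
  have hd : ∀ g ∈ s, HasDerivWithinAt (fun g => Real.exp (-g)) (-Real.exp (-g)) s g := fun g _ => by
    simpa using (hasDerivAt_neg g).exp.hasDerivWithinAt
  rw [lintegral_image_eq_lintegral_abs_deriv_mul hs hd fun a _ b _ hab => by simpa using hab,
    gumbelMeasure, restrict_withDensity hs,
    lintegral_withDensity_eq_lintegral_mul _ (by fun_prop) (by fun_prop)]
  refine lintegral_congr fun g => ?_
  simp only [Pi.mul_apply, abs_neg, abs_of_pos (Real.exp_pos _)]
  rw [← mul_assoc, ← ENNReal.ofReal_mul (Real.exp_pos _).le, ← Real.exp_add, neg_add]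

lemma setLIntegral_Iio_gumbelMeasure (h : ℝ) {φ : ℝ → ℝ≥0∞} (hφ : Measurable φ) :
    ∫⁻ g in Set.Iio h, φ (Real.exp (-g)) ∂gumbelMeasure
      = ∫⁻ v in Set.Ioi (Real.exp (-h)), ENNReal.ofReal (Real.exp (-v)) * φ v := by
  have himg : (fun g : ℝ => Real.exp (-g)) '' Set.Iio h = Set.Ioi (Real.exp (-h)) := by
    ext v
    constructor
    · rintro ⟨g, hg, rfl⟩
      exact Real.exp_lt_exp.2 (neg_lt_neg hg)
    · intro hv
      have hv0 : 0 < v := (Real.exp_pos _).trans hv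
      refine ⟨-Real.log v, ?_, by simp [Real.exp_log hv0]⟩
      have := Real.log_lt_log (Real.exp_pos _) hv
      rw [Real.log_exp] at this
      simp only [Set.mem_Iio]
      linarith
  rw [setLIntegral_gumbelMeasure measurableSet_Iio hφ, himg]

lemma lintegral_gumbelMeasure {φ : ℝ → ℝ≥0∞} (hφ : Measurable φ) :
    ∫⁻ g, φ (Real.exp (-g)) ∂gumbelMeasure = expTail 0 φ := by
  have himg : (fun g : ℝ => Real.exp (-g)) '' Set.univ = Set.Ioi 0 := by
    ext v
    constructor
    · rintro ⟨g, -, rfl⟩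
      exact Real.exp_pos _
    · intro hv
      exact ⟨-Real.log v, trivial, by simp [Real.exp_log hv]⟩
  rw [← setLIntegral_univ, setLIntegral_gumbelMeasure MeasurableSet.univ hφ, himg, expTail]
  simp

/-- Memorylessness: truncating the Gumbel variable below `h` conditions the exponential variable to
exceed `exp (-h)`, and the excess is again standard exponential. -/
lemma lintegral_cond_gumbelMeasure (h : ℝ) {φ : ℝ → ℝ≥0∞} (hφ : Measurable φ) :
    ∫⁻ g, φ (Real.exp (-g)) ∂(ProbabilityTheory.cond gumbelMeasure (Set.Iio h))
      = expTail (Real.exp (-h)) φ := by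
  have h1 : gumbelMeasure (Set.Iio h) = ENNReal.ofReal (Real.exp (-Real.exp (-h))) := by
    have := setLIntegral_Iio_gumbelMeasure h (φ := fun _ => 1) measurable_const
    simpa [lintegral_Ioi_exp_neg] using this
  rw [ProbabilityTheory.cond, lintegral_smul_measure, setLIntegral_Iio_gumbelMeasure h hφ, h1,
    expTail_eq, ← ENNReal.ofReal_inv_of_pos (Real.exp_pos _), ← Real.exp_neg, neg_neg, smul_eq_mul]

/-! ### The marked arrival process -/

section Chain

variable {Ω 𝓧 : Type*}

/-- The points `(exp (-G n), X n)` of the marked arrival process. -/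
noncomputable def markedPoint (X : ℕ → Ω → 𝓧) (G : ℕ → Ω → ℝ) (n : ℕ) (ω : Ω) : ℝ × 𝓧 :=
  (Real.exp (-G n ω), X n ω)

/-- The sequence of marked points stopped at index `n`. -/
noncomputable def stoppedPoints (X : ℕ → Ω → 𝓧) (G : ℕ → Ω → ℝ) (n : ℕ) (ω : Ω) : ℕ → ℝ × 𝓧 :=
  fun i => markedPoint X G (min i n) ω

lemma stoppedPoints_apply_of_le (X : ℕ → Ω → 𝓧) (G : ℕ → Ω → ℝ) {i n : ℕ} (h : i ≤ n) (ω : Ω) :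
    stoppedPoints X G n ω i = markedPoint X G i ω := by
  rw [stoppedPoints, min_eq_left h]

variable [MeasurableSpace Ω] [MeasurableSpace 𝓧]
  {μ : Measure Ω} [IsProbabilityMeasure μ] {P : Measure 𝓧} {X : ℕ → Ω → 𝓧} {G : ℕ → Ω → ℝ}

namespace IsSharedRandomness

variable (H : IsSharedRandomness μ P X G)
include H

lemma isProbabilityMeasure : IsProbabilityMeasure P := by
  rw [← H.law_X 0]
  exact Measure.isProbabilityMeasure_map (H.measurable_X 0).aemeasurable

lemma measurable_markedPoint (n : ℕ) : Measurable (markedPoint X G n) :=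
  (Real.measurable_exp.comp (H.measurable_G n).neg).prodMk (H.measurable_X n)

lemma measurable_stoppedPoints (n : ℕ) : Measurable (stoppedPoints X G n) :=
  measurable_pi_iff.2 fun _ => H.measurable_markedPoint _

/-- The law of the first marked point. -/
lemma lintegral_markedPoint_zero {F : ℝ × 𝓧 → ℝ≥0∞} (hF : Measurable F) :
    ∫⁻ ω, F (markedPoint X G 0 ω) ∂μ = expTail 0 fun v => ∫⁻ x, F (v, x) ∂P := by
  have hP := H.isProbabilityMeasure
  have hind : IndepFun (G 0) (X 0) μ :=
    (H.indep_XG.comp (φ := fun x : ℕ → 𝓧 => x 0) (ψ := fun g : ℕ → ℝ => g 0) (by fun_prop)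
      (by fun_prop)).symm
  have hlaw := (indepFun_iff_map_prod_eq_prod_map_map (H.measurable_G 0).aemeasurable
    (H.measurable_X 0).aemeasurable).1 hind
  have h1 : ∫⁻ ω, F (markedPoint X G 0 ω) ∂μ
      = ∫⁻ p, F (Real.exp (-p.1), p.2) ∂(μ.map fun ω => (G 0 ω, X 0 ω)) := by
    rw [lintegral_map (by fun_prop) ((H.measurable_G 0).prodMk (H.measurable_X 0))]
    rfl
  rw [h1, hlaw, H.law_X, lintegral_prod _ (by fun_prop), H.law_G_zero]
  exact lintegral_gumbelMeasure (φ := fun v => ∫⁻ x, F (v, x) ∂P) hF.lintegral_prod_right'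

/-- The conditional law of a marked point given the preceding ones. -/
lemma lintegral_markedPoint_succ (n : ℕ) {F : (ℕ → ℝ × 𝓧) × (ℝ × 𝓧) → ℝ≥0∞}
    (hF : Measurable F) :
    ∫⁻ ω, F (stoppedPoints X G n ω, markedPoint X G (n + 1) ω) ∂μ
      = ∫⁻ ω, expTail (Real.exp (-G n ω))
        (fun v => ∫⁻ x, F (stoppedPoints X G n ω, (v, x)) ∂P) ∂μ := by
  have hP := H.isProbabilityMeasure
  set A : Ω → (Fin (n + 1) → 𝓧) := fun ω j => X j ω with hA
  set B : Ω → (Fin (n + 1) → ℝ) := fun ω j => G j ω with hB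
  have hAm : Measurable A := measurable_pi_iff.2 fun j => H.measurable_X _
  have hBm : Measurable B := measurable_pi_iff.2 fun j => H.measurable_G _
  have hXm := H.measurable_X (n + 1)
  have hGm := H.measurable_G (n + 1)
  -- The stopped sequence depends only on the finite histories `A` and `B`. Expressing it through
  -- them makes `law_G_succ`, which conditions on a finite history, applicable.
  let σ : (Fin (n + 1) → 𝓧) → (Fin (n + 1) → ℝ) → (ℕ → ℝ × 𝓧) := fun a b i =>
    (Real.exp (-b ⟨min i n, by omega⟩), a ⟨min i n, by omega⟩)
  have hσ : Measurable fun p : (Fin (n + 1) → 𝓧) × (Fin (n + 1) → ℝ) => σ p.1 p.2 := by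
    refine measurable_pi_iff.2 fun i => ?_
    simp only [σ]
    fun_prop
  have hσω : ∀ ω, stoppedPoints X G n ω = σ (A ω) (B ω) := fun ω => rfl
  have hindX : IndepFun A (X (n + 1)) μ := by
    have h := H.indep_X.indepFun_finset (Finset.range (n + 1)) {n + 1} (by simp) H.measurable_X
    exact h.comp
      (φ := fun (x : Finset.range (n + 1) → 𝓧) (j : Fin (n + 1)) => x ⟨j, Finset.mem_range.2 j.2⟩)
      (ψ := fun x : ({n + 1} : Finset ℕ) → 𝓧 => x ⟨n + 1, Finset.mem_singleton_self _⟩)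
      (by fun_prop) (by fun_prop)
  have hindXG : IndepFun (fun ω => (A ω, X (n + 1) ω)) (fun ω => (B ω, G (n + 1) ω)) μ :=
    H.indep_XG.comp (φ := fun x : ℕ → 𝓧 => ((fun j : Fin (n + 1) => x j), x (n + 1)))
      (ψ := fun g : ℕ → ℝ => ((fun j : Fin (n + 1) => g j), g (n + 1)))
      (by fun_prop) (by fun_prop)
  have hindAB : IndepFun A B μ := hindXG.comp measurable_fst measurable_fst
  have hlawX := (indepFun_iff_map_prod_eq_prod_map_map hAm.aemeasurable hXm.aemeasurable).1 hindX
  have hlawAB := (indepFun_iff_map_prod_eq_prod_map_map hAm.aemeasurable hBm.aemeasurable).1 hindAB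
  have hlaw := (indepFun_iff_map_prod_eq_prod_map_map (hAm.prodMk hXm).aemeasurable
    (hBm.prodMk hGm).aemeasurable).1 hindXG
  have hlawG : μ.map (fun ω => (B ω, G (n + 1) ω))
      = (μ.map B) ⊗ₘ condDistrib (G (n + 1)) B μ := (compProd_map_condDistrib hGm.aemeasurable).symm
  have hα : IsProbabilityMeasure (μ.map A) := Measure.isProbabilityMeasure_map hAm.aemeasurable
  have hβ : IsProbabilityMeasure (μ.map B) := Measure.isProbabilityMeasure_map hBm.aemeasurable
  have hFσ : Measurable fun q : ((Fin (n + 1) → 𝓧) × 𝓧) × ((Fin (n + 1) → ℝ) × ℝ) =>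
      F (σ q.1.1 q.2.1, (Real.exp (-q.2.2), q.1.2)) := by
    refine hF.comp (Measurable.prodMk ?_ (by fun_prop))
    exact hσ.comp ((measurable_fst.comp measurable_fst).prodMk (measurable_fst.comp measurable_snd))
  have hFv : Measurable fun q : ((Fin (n + 1) → 𝓧) × (Fin (n + 1) → ℝ)) × (ℝ × 𝓧) =>
      F (σ q.1.1 q.1.2, q.2) := hF.comp ((hσ.comp measurable_fst).prodMk measurable_snd)
  have hL : ∫⁻ ω, F (stoppedPoints X G n ω, markedPoint X G (n + 1) ω) ∂μ
      = ∫⁻ a, ∫⁻ x, ∫⁻ b, expTail (Real.exp (-b (Fin.last n))) (fun v => F (σ a b, (v, x)))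
          ∂(μ.map B) ∂P ∂(μ.map A) := by
    have h1 : ∫⁻ ω, F (stoppedPoints X G n ω, markedPoint X G (n + 1) ω) ∂μ
        = ∫⁻ q, F (σ q.1.1 q.2.1, (Real.exp (-q.2.2), q.1.2))
          ∂(μ.map fun ω => ((A ω, X (n + 1) ω), (B ω, G (n + 1) ω))) := by
      rw [lintegral_map hFσ ((hAm.prodMk hXm).prodMk (hBm.prodMk hGm))]
      rfl
    rw [h1, hlaw, hlawX, H.law_X, hlawG, lintegral_prod _ hFσ.aemeasurable,
      lintegral_prod _ hFσ.lintegral_prod_right'.aemeasurable]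
    refine lintegral_congr fun a => lintegral_congr fun x => ?_
    rw [Measure.lintegral_compProd (by fun_prop)]
    refine lintegral_congr_ae ?_
    filter_upwards [H.law_G_succ n] with b hb
    rw [hb]
    exact lintegral_cond_gumbelMeasure (b (Fin.last n)) (φ := fun v => F (σ a b, (v, x)))
      (by fun_prop)
  have hR : ∫⁻ ω, expTail (Real.exp (-G n ω))
        (fun v => ∫⁻ x, F (stoppedPoints X G n ω, (v, x)) ∂P) ∂μ
      = ∫⁻ a, ∫⁻ b, expTail (Real.exp (-b (Fin.last n))) (fun v => ∫⁻ x, F (σ a b, (v, x)) ∂P)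
          ∂(μ.map B) ∂(μ.map A) := by
    have hm : Measurable fun q : (Fin (n + 1) → 𝓧) × (Fin (n + 1) → ℝ) =>
        expTail (Real.exp (-q.2 (Fin.last n))) (fun v => ∫⁻ x, F (σ q.1 q.2, (v, x)) ∂P) := by
      refine measurable_expTail (by fun_prop) ?_
      refine Measurable.lintegral_prod_right' (f := fun p : (((Fin (n + 1) → 𝓧) ×
        (Fin (n + 1) → ℝ)) × ℝ) × 𝓧 => F (σ p.1.1.1 p.1.1.2, (p.1.2, p.2))) ?_
      exact hFv.comp (g := fun q : ((Fin (n + 1) → 𝓧) × (Fin (n + 1) → ℝ)) × (ℝ × 𝓧) =>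
        F (σ q.1.1 q.1.2, q.2)) (f := fun p : (((Fin (n + 1) → 𝓧) ×
        (Fin (n + 1) → ℝ)) × ℝ) × 𝓧 => (p.1.1, (p.1.2, p.2))) (by fun_prop)
    rw [← lintegral_prod _ hm.aemeasurable, ← hlawAB, lintegral_map hm (hAm.prodMk hBm)]
    rfl
  rw [hL, hR]
  refine lintegral_congr fun a => ?_
  have hm : ∀ a : Fin (n + 1) → 𝓧, Measurable fun p : 𝓧 × (Fin (n + 1) → ℝ) =>
      expTail (Real.exp (-p.2 (Fin.last n))) (fun v => F (σ a p.2, (v, p.1))) := by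
    intro a
    refine measurable_expTail (by fun_prop) ?_
    exact hFv.comp (g := fun q : ((Fin (n + 1) → 𝓧) × (Fin (n + 1) → ℝ)) × (ℝ × 𝓧) =>
        F (σ q.1.1 q.1.2, q.2)) (f := fun p : (𝓧 × (Fin (n + 1) → ℝ)) × ℝ =>
          ((a, p.1.2), (p.2, p.1.1))) (by fun_prop)
  rw [lintegral_lintegral_swap (hm a).aemeasurable]
  refine lintegral_congr fun b => ?_
  simp only [expTail]
  have hFab : Measurable fun z : ℝ × 𝓧 => F (σ a b, z) := by fun_prop
  rw [lintegral_lintegral_swap]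
  · refine lintegral_congr fun v => ?_
    rw [lintegral_const_mul _ (by fun_prop)]
  · exact (Measurable.mul (by fun_prop) (hFab.comp measurable_swap)).aemeasurable

end IsSharedRandomness
end Chain

/-! ### Integrating out successive points of the process -/

section StepOp

variable {𝓧 : Type*} [MeasurableSpace 𝓧]

/-- The operator that integrates out one marked point, weighted by `β`. -/
noncomputable def stepOp (P : Measure 𝓧) (β : ℝ × 𝓧 → ℝ≥0∞) (ψ : ℝ → ℝ≥0∞) (s : ℝ) : ℝ≥0∞ :=
  expTail s fun v => (∫⁻ x, β (v, x) ∂P) * ψ v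

lemma measurable_stepOp {E : Type*} [MeasurableSpace E] {P : Measure 𝓧} [SFinite P]
    {β : E → ℝ × 𝓧 → ℝ≥0∞} (hβ : Measurable (Function.uncurry β))
    {ψ : E → ℝ → ℝ≥0∞} (hψ : Measurable (Function.uncurry ψ)) :
    Measurable (Function.uncurry fun e s => stepOp P (β e) (ψ e) s) := by
  refine measurable_expTail (α := E × ℝ) (s := fun p => p.2)
    (φ := fun p v => (∫⁻ x, β p.1 (v, x) ∂P) * ψ p.1 v) measurable_snd ?_
  have h1 : Measurable fun q : (E × ℝ) × ℝ => ∫⁻ x, β q.1.1 (q.2, x) ∂P := by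
    refine Measurable.lintegral_prod_right'
      (f := fun p : ((E × ℝ) × ℝ) × 𝓧 => β p.1.1.1 (p.1.2, p.2)) ?_
    exact hβ.comp (g := Function.uncurry β)
      (f := fun p : ((E × ℝ) × ℝ) × 𝓧 => (p.1.1.1, (p.1.2, p.2))) (by fun_prop)
  have h2 : Measurable fun q : (E × ℝ) × ℝ => ψ q.1.1 q.2 :=
    hψ.comp (g := Function.uncurry ψ) (f := fun q : (E × ℝ) × ℝ => (q.1.1, q.2)) (by fun_prop)
  exact h1.mul h2

lemma measurable_uncurry_iterate_stepOp {E : Type*} [MeasurableSpace E] {P : Measure 𝓧} [SFinite P]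
    {β : E → ℝ × 𝓧 → ℝ≥0∞} (hβ : Measurable (Function.uncurry β))
    {ψ : E → ℝ → ℝ≥0∞} (hψ : Measurable (Function.uncurry ψ)) (m : ℕ) :
    Measurable (Function.uncurry fun e s => (stepOp P (β e))^[m] (ψ e) s) := by
  induction m with
  | zero => exact hψ
  | succ m ih =>
    simp only [Function.iterate_succ_apply']
    exact measurable_stepOp hβ ih

lemma measurable_iterate_stepOp {P : Measure 𝓧} [SFinite P]
    {β : ℝ × 𝓧 → ℝ≥0∞} (hβ : Measurable β) {ψ : ℝ → ℝ≥0∞} (hψ : Measurable ψ) (m : ℕ) :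
    Measurable ((stepOp P β)^[m] ψ) :=
  (measurable_uncurry_iterate_stepOp (E := Unit) (β := fun _ => β) (ψ := fun _ => ψ)
    (hβ.comp measurable_snd) (hψ.comp measurable_snd) m).comp (measurable_prodMk_left (x := ()))

lemma stepOp_const_mul {P : Measure 𝓧} [SFinite P]
    {β : ℝ × 𝓧 → ℝ≥0∞} (hβ : Measurable β) {ψ : ℝ → ℝ≥0∞} (hψ : Measurable ψ) (c : ℝ≥0∞) :
    stepOp P β (fun t => c * ψ t) = fun t => c * stepOp P β ψ t := by
  ext s
  rw [stepOp, stepOp, ← expTail_const_mul]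
  · simp_rw [mul_left_comm]
  · exact (hβ.lintegral_prod_right').mul hψ

lemma iterate_stepOp_const_mul {P : Measure 𝓧} [SFinite P]
    {β : ℝ × 𝓧 → ℝ≥0∞} (hβ : Measurable β) {ψ : ℝ → ℝ≥0∞} (hψ : Measurable ψ) (c : ℝ≥0∞) (m : ℕ) :
    (stepOp P β)^[m] (fun t => c * ψ t) = fun t => c * (stepOp P β)^[m] ψ t := by
  induction m with
  | zero => rfl
  | succ m ih =>
    rw [Function.iterate_succ_apply', ih, Function.iterate_succ_apply',
      stepOp_const_mul hβ (measurable_iterate_stepOp hβ hψ m)]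

variable {Ω : Type*} [MeasurableSpace Ω]
  {μ : Measure Ω} [IsProbabilityMeasure μ] {P : Measure 𝓧} {X : ℕ → Ω → 𝓧} {G : ℕ → Ω → ℝ}

namespace IsSharedRandomness

variable (H : IsSharedRandomness μ P X G)
include H

/-- Integrating out the marked points with indices in `(n, n + m]`. -/
lemma lintegral_prod_markedPoint_after (n m : ℕ) {β : (ℕ → ℝ × 𝓧) → ℝ × 𝓧 → ℝ≥0∞}
    (hβ : Measurable (Function.uncurry β)) {ψ : (ℕ → ℝ × 𝓧) → ℝ → ℝ≥0∞}
    (hψ : Measurable (Function.uncurry ψ)) :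
    ∫⁻ ω, (∏ j ∈ Finset.range m, β (stoppedPoints X G n ω) (markedPoint X G (n + 1 + j) ω))
        * ψ (stoppedPoints X G n ω) (Real.exp (-G (n + m) ω)) ∂μ
      = ∫⁻ ω, (stepOp P (β (stoppedPoints X G n ω)))^[m] (ψ (stoppedPoints X G n ω))
          (Real.exp (-G n ω)) ∂μ := by
  have hP := H.isProbabilityMeasure
  induction m generalizing ψ with
  | zero => simp
  | succ m ih =>
    -- `β` and `ψ` may look only at the history up to `n`, while the one-step law is applied at `n +
    -- m`; `τ` discards what lies between.
    let τ : (ℕ → ℝ × 𝓧) → (ℕ → ℝ × 𝓧) := fun s i => s (min i n)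
    have hτ : Measurable τ := measurable_pi_iff.2 fun i => measurable_pi_apply _
    have hτω : ∀ ω, τ (stoppedPoints X G (n + m) ω) = stoppedPoints X G n ω := fun ω => by
      ext1 i
      simp only [τ, stoppedPoints]
      congr 1
      omega
    let F : (ℕ → ℝ × 𝓧) × (ℝ × 𝓧) → ℝ≥0∞ := fun p =>
      (∏ j ∈ Finset.range m, β (τ p.1) (p.1 (n + 1 + j))) * (β (τ p.1) p.2 * ψ (τ p.1) p.2.1)
    have hF : Measurable F := by
      refine Measurable.mul (Finset.measurable_prod _ fun j _ => ?_) (Measurable.mul ?_ ?_)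
      · exact hβ.comp (g := Function.uncurry β) (f := fun p : (ℕ → ℝ × 𝓧) × (ℝ × 𝓧) =>
          (τ p.1, p.1 (n + 1 + j))) (by fun_prop)
      · exact hβ.comp (g := Function.uncurry β) (f := fun p : (ℕ → ℝ × 𝓧) × (ℝ × 𝓧) =>
          (τ p.1, p.2)) (by fun_prop)
      · exact hψ.comp (g := Function.uncurry ψ) (f := fun p : (ℕ → ℝ × 𝓧) × (ℝ × 𝓧) =>
          (τ p.1, p.2.1)) (by fun_prop)
    have hprod : ∀ ω, (∏ j ∈ Finset.range m, β (stoppedPoints X G n ω)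
        (stoppedPoints X G (n + m) ω (n + 1 + j))) = ∏ j ∈ Finset.range m,
          β (stoppedPoints X G n ω) (markedPoint X G (n + 1 + j) ω) := fun ω => by
      refine Finset.prod_congr rfl fun j hj => ?_
      rw [stoppedPoints_apply_of_le X G (by have := Finset.mem_range.1 hj; omega)]
    calc _ = ∫⁻ ω, F (stoppedPoints X G (n + m) ω, markedPoint X G (n + m + 1) ω) ∂μ := by
          refine lintegral_congr fun ω => ?_
          simp only [F, hτω, hprod]
          rw [Finset.prod_range_succ, show n + 1 + m = n + m + 1 by omega,
            show n + (m + 1) = n + m + 1 by omega, mul_assoc]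
          rfl
      _ = _ := by
          rw [H.lintegral_markedPoint_succ (n + m) hF]
          simp only [Function.iterate_succ_apply]
          -- Integrating out the last point replaces `ψ` by its image under `stepOp`, which is why
          -- the induction runs over all `ψ`.
          rw [← ih (ψ := fun e => stepOp P (β e) (ψ e)) (measurable_stepOp hβ hψ)]
          refine lintegral_congr fun ω => ?_
          simp only [F, hτω, hprod]
          have hβω : Measurable (β (stoppedPoints X G n ω)) := hβ.of_uncurry_left
          have hψω : Measurable (ψ (stoppedPoints X G n ω)) := hψ.of_uncurry_left
          rw [stepOp, ← expTail_const_mul]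
          · congr 1
            ext v
            rw [lintegral_const_mul _ (by fun_prop), lintegral_mul_const _ (by fun_prop)]
          · exact (hβω.lintegral_prod_right').mul hψω

/-- Integrating out the marked points with indices in `[0, n]`. -/
lemma lintegral_prod_markedPoint (n : ℕ) {β : ℝ × 𝓧 → ℝ≥0∞}
    (hβ : Measurable β) {ψ : ℝ → ℝ≥0∞} (hψ : Measurable ψ) :
    ∫⁻ ω, (∏ j ∈ Finset.range (n + 1), β (markedPoint X G j ω)) * ψ (Real.exp (-G n ω)) ∂μ
      = (stepOp P β)^[n + 1] ψ 0 := by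
  have hP := H.isProbabilityMeasure
  -- The point with index `0` is not among those integrated out here, so its weight is carried
  -- inside `ψ`.
  have h := H.lintegral_prod_markedPoint_after 0 n (β := fun _ => β)
    (ψ := fun e t => β (e 0) * ψ t) (hβ.comp measurable_snd)
    (Measurable.mul (by fun_prop : Measurable fun p : (ℕ → ℝ × 𝓧) × ℝ => β (p.1 0))
      (hψ.comp measurable_snd))
  simp only [iterate_stepOp_const_mul hβ hψ, zero_add,
    stoppedPoints_apply_of_le X G le_rfl] at h
  have hm := measurable_iterate_stepOp (P := P) hβ hψ n
  calc _ = ∫⁻ ω, (∏ j ∈ Finset.range n, β (markedPoint X G (1 + j) ω))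
        * (β (markedPoint X G 0 ω) * ψ (Real.exp (-G n ω))) ∂μ := by
        refine lintegral_congr fun ω => ?_
        rw [Finset.prod_range_succ']
        simp_rw [add_comm 1, mul_assoc]
    _ = ∫⁻ ω, (fun z : ℝ × 𝓧 => β z * (stepOp P β)^[n] ψ z.1) (markedPoint X G 0 ω) ∂μ := h
    _ = _ := by
        rw [H.lintegral_markedPoint_zero (F := fun z => β z * (stepOp P β)^[n] ψ z.1)
          (hβ.mul (hm.comp measurable_fst)), Function.iterate_succ_apply', stepOp]
        congr 1
        ext v
        change ∫⁻ x, β (v, x) * (stepOp P β)^[n] ψ v ∂P = _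
        exact lintegral_mul_const _ (by fun_prop)

end IsSharedRandomness

/-! ### Explicit iterates -/

/-- The integrand has antiderivative `-(∫ w in v..u, b w) ^ (k + 1) / (k + 1)` wherever `b` is
continuous. Monotonicity leaves only countably many exceptions, which the fundamental theorem of
calculus tolerates. -/
lemma integral_mul_integral_pow {b : ℝ → ℝ} (hb : Monotone b) {s u : ℝ} (hsu : s ≤ u) (k : ℕ) :
    ∫ v in s..u, b v * (∫ w in v..u, b w) ^ k = (∫ w in s..u, b w) ^ (k + 1) / (k + 1) := by
  have hi : ∀ a c, IntervalIntegrable b volume a c := fun a c => hb.intervalIntegrable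
  have hcont : Continuous fun v => ∫ w in v..u, b w := by
    have := (intervalIntegral.continuous_primitive hi u).neg
    refine this.congr fun v => ?_
    rw [intervalIntegral.integral_symm u v]
    simp
  have hint : IntervalIntegrable (fun v => b v * (∫ w in v..u, b w) ^ k) volume s u :=
    (hi s u).mul_continuousOn (hcont.pow k).continuousOn
  have hder : ∀ v ∈ Set.Ioo s u \ {x | ¬ ContinuousAt b x},
      HasDerivAt (fun v => -((∫ w in v..u, b w) ^ (k + 1) / (k + 1)))
        (b v * (∫ w in v..u, b w) ^ k) v := by
    rintro v ⟨-, hv⟩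
    have hv : ContinuousAt b v := not_not.1 hv
    have h1 := intervalIntegral.integral_hasDerivAt_left (hi v u)
      hb.measurable.stronglyMeasurable.stronglyMeasurableAtFilter hv
    have h2 := ((h1.pow (k + 1)).div_const ((k : ℝ) + 1)).neg
    have h3 : -(((k + 1 : ℕ) : ℝ) * (∫ w in v..u, b w) ^ (k + 1 - 1) * -b v / ((k : ℝ) + 1))
        = b v * (∫ w in v..u, b w) ^ k := by
      have : (k : ℝ) + 1 ≠ 0 := by positivity
      simp only [Nat.add_sub_cancel]
      push_cast
      field_simp
    exact h3 ▸ h2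
  have := integral_eq_of_hasDerivAt_off_countable_of_le _ _ hsu
    (hb.countable_not_continuousAt) (by fun_prop : Continuous fun v =>
      -((∫ w in v..u, b w) ^ (k + 1) / (k + 1))).continuousOn hder hint
  rw [this]
  simp

/-- The weight of `k` accepted points in `(s, u]`, when points at `v` are accepted with
probability `b v`. -/
noncomputable def acceptedWeight (b : ℝ → ℝ) (u : ℝ) (k : ℕ) (s : ℝ) : ℝ≥0∞ :=
  if s ≤ u then ENNReal.ofReal (Real.exp (-(u - s)) * ((∫ v in s..u, b v) ^ k / k.factorial)) else 0

/-- The waiting-time factors `exp (-(v - s))` and `exp (-(u - v))` combine to `exp (-(u - s))`,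
independent of the intermediate arrival `v`. What is left is the iterated integral of `b` over a
simplex, the source of the factorial. -/
lemma stepOp_acceptedWeight {P : Measure 𝓧} {β : ℝ × 𝓧 → ℝ≥0∞} {b : ℝ → ℝ} (hb : Monotone b)
    (hb0 : ∀ v, 0 ≤ b v) (hβ : ∀ v, ∫⁻ x, β (v, x) ∂P = ENNReal.ofReal (b v)) (u : ℝ) (k : ℕ) :
    stepOp P β (acceptedWeight b u k) = acceptedWeight b u (k + 1) := by
  ext s
  have hi : ∀ a c, IntervalIntegrable b volume a c := fun a c => hb.intervalIntegrable
  rw [stepOp, expTail]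
  simp_rw [hβ]
  by_cases hsu : s ≤ u
  · have hcont : Continuous fun v => ∫ w in v..u, b w := by
      have := (intervalIntegral.continuous_primitive hi u).neg
      refine this.congr fun v => ?_
      rw [intervalIntegral.integral_symm u v]
      simp
    have h0 : ∀ v ≤ u, 0 ≤ ∫ w in v..u, b w := fun v hv =>
      intervalIntegral.integral_nonneg hv fun w _ => hb0 w
    have hint : IntegrableOn (fun v => Real.exp (-(u - s)) *
        (b v * (∫ w in v..u, b w) ^ k / k.factorial)) (Set.Ioc s u) := by
      have : IntervalIntegrable (fun v => b v * (∫ w in v..u, b w) ^ k) volume s u :=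
        (hi s u).mul_continuousOn (hcont.pow k).continuousOn
      exact ((this.div_const _).const_mul _).1
    calc _ = ∫⁻ v in Set.Ioc s u, ENNReal.ofReal (Real.exp (-(u - s)) *
          (b v * (∫ w in v..u, b w) ^ k / k.factorial)) := by
          rw [← Set.Ioc_union_Ioi_eq_Ioi hsu, lintegral_union measurableSet_Ioi
            (Set.disjoint_left.2 fun v hv hv' => not_lt.2 hv.2 hv')]
          rw [setLIntegral_congr_fun (s := Set.Ioi u) (g := fun _ => 0) measurableSet_Ioi
            (fun v hv => by simp [acceptedWeight, not_le.2 (Set.mem_Ioi.1 hv)])]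
          simp only [lintegral_zero, add_zero]
          refine setLIntegral_congr_fun measurableSet_Ioc fun v hv => ?_
          simp only [acceptedWeight, if_pos hv.2]
          rw [← ENNReal.ofReal_mul (hb0 v), ← ENNReal.ofReal_mul (Real.exp_pos _).le]
          congr 1
          rw [show -(u - s) = -(v - s) + -(u - v) by ring, Real.exp_add]
          ring
      _ = _ := by
          rw [← ofReal_integral_eq_lintegral_ofReal hint]
          · rw [acceptedWeight, if_pos hsu, ← intervalIntegral.integral_of_le hsu,
              intervalIntegral.integral_const_mul, intervalIntegral.integral_div,
              integral_mul_integral_pow hb hsu, Nat.factorial_succ]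
            congr 2
            push_cast
            rw [div_div]
          · filter_upwards [ae_restrict_mem measurableSet_Ioc] with v hv
            have := hb0 v
            have := h0 v hv.2
            positivity
  · rw [acceptedWeight, if_neg hsu]
    rw [setLIntegral_congr_fun (g := fun _ => 0) measurableSet_Ioi (fun v hv => ?_)]
    · simp
    · simp [acceptedWeight, not_le.2 ((not_le.1 hsu).trans (Set.mem_Ioi.1 hv))]

lemma iterate_stepOp_acceptedWeight {P : Measure 𝓧} {β : ℝ × 𝓧 → ℝ≥0∞} {b : ℝ → ℝ}
    (hb : Monotone b) (hb0 : ∀ v, 0 ≤ b v)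
    (hβ : ∀ v, ∫⁻ x, β (v, x) ∂P = ENNReal.ofReal (b v)) (u : ℝ) (k : ℕ) :
    (stepOp P β)^[k] (acceptedWeight b u 0) = acceptedWeight b u k := by
  induction k with
  | zero => rfl
  | succ k ih => rw [Function.iterate_succ_apply', ih, stepOp_acceptedWeight hb hb0 hβ]

end StepOp

/-! ### Acceptance probabilities, points before a given one, and intensity -/

section Accept

variable {𝓧 : Type*} [MeasurableSpace 𝓧]

lemma acceptedWeight_zero (b : ℝ → ℝ) (u s : ℝ) : acceptedWeight b u 0 s
    = if s ≤ u then ENNReal.ofReal (Real.exp (-(u - s))) else 0 := by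
  simp [acceptedWeight]

/-- The family `β` of acceptance indicators has the acceptance probabilities `b`. -/
structure IsAcceptance (P : Measure 𝓧) (β : ℝ × 𝓧 → ℝ × 𝓧 → ℝ≥0∞) (b : ℝ × 𝓧 → ℝ → ℝ) : Prop where
  measurable : Measurable (Function.uncurry β)
  monotone : ∀ z, Monotone (b z)
  nonneg : ∀ z v, 0 ≤ b z v
  lintegral_eq : ∀ z v, ∫⁻ x, β z (v, x) ∂P = ENNReal.ofReal (b z v)

lemma measurable_acceptedWeight_zero {E : Type*} [MeasurableSpace E] (b : E → ℝ → ℝ)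
    {u s : E → ℝ} (hu : Measurable u) (hs : Measurable s) :
    Measurable fun e => acceptedWeight (b e) (u e) 0 (s e) := by
  simp_rw [acceptedWeight_zero]
  exact Measurable.ite (measurableSet_le hs hu) (by fun_prop) measurable_const

/-- No joint measurability of `b` is assumed; it is recovered from that of `β`, because the weight
is an iterate of `stepOp`. -/
lemma IsAcceptance.measurable_acceptedWeight {P : Measure 𝓧} [SFinite P]
    {β : ℝ × 𝓧 → ℝ × 𝓧 → ℝ≥0∞} {b : ℝ × 𝓧 → ℝ → ℝ} (hb : IsAcceptance P β b)
    {u s : ℝ × 𝓧 → ℝ} (hu : Measurable u) (hs : Measurable s) (k : ℕ) :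
    Measurable fun z => acceptedWeight (b z) (u z) k (s z) := by
  have h := (measurable_uncurry_iterate_stepOp (P := P) hb.measurable
    (ψ := fun z t => acceptedWeight (b z) (u z) 0 t)
    (measurable_acceptedWeight_zero (E := (ℝ × 𝓧) × ℝ) (fun e => b e.1) (hu.comp measurable_fst)
      measurable_snd) k).comp (measurable_id.prodMk hs)
  convert h using 2 with z
  exact (congrFun (iterate_stepOp_acceptedWeight (hb.monotone z) (hb.nonneg z)
    (hb.lintegral_eq z) (u z) k) (s z)).symm

/-- First reading of the weight with no accepted points: as a function of `v`, it is the density of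
the next arrival after `s`. -/
lemma lintegral_Ioi_acceptedWeight_zero {s : ℝ} (hs : 0 < s) (b : ℝ → ℝ → ℝ) (φ : ℝ → ℝ≥0∞) :
    ∫⁻ v in Set.Ioi 0, acceptedWeight (b v) v 0 s * φ v = expTail s φ := by
  have h : ∀ v, acceptedWeight (b v) v 0 s * φ v
      = (Set.Ici s).indicator (fun v => ENNReal.ofReal (Real.exp (-(v - s))) * φ v) v := fun v => by
    by_cases hv : s ≤ v <;> simp [acceptedWeight_zero, Set.indicator, hv]
  simp_rw [h]
  rw [setLIntegral_indicator measurableSet_Ici, expTail]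
  rw [Set.inter_eq_left.2 (Set.Ici_subset_Ioi.2 hs)]
  exact setLIntegral_congr Ioi_ae_eq_Ici.symm

/-- Second reading of the same exponential: the probability that no arrival falls in `(s, u]`. -/
lemma expTail_indicator_Ioi {s u : ℝ} (hsu : s ≤ u) :
    expTail s ((Set.Ioi u).indicator fun _ => 1) = ENNReal.ofReal (Real.exp (-(u - s))) := by
  have h : ∀ v, ENNReal.ofReal (Real.exp (-v)) * (Set.Ioi u).indicator (fun _ => (1 : ℝ≥0∞)) v
      = (Set.Ioi u).indicator (fun v => ENNReal.ofReal (Real.exp (-v))) v := fun v => by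
    by_cases hv : u < v <;> simp [Set.indicator, hv]
  rw [expTail_eq]
  simp_rw [h]
  rw [setLIntegral_indicator measurableSet_Ioi, Set.inter_eq_left.2 (Set.Ioi_subset_Ioi hsu),
    lintegral_Ioi_exp_neg, ← ENNReal.ofReal_mul (Real.exp_pos _).le, ← Real.exp_add]
  ring_nf

lemma ENNReal.tsum_ofReal_pow_div_factorial {A : ℝ} (hA : 0 ≤ A) :
    ∑' n : ℕ, ENNReal.ofReal (A ^ n / n.factorial) = ENNReal.ofReal (Real.exp A) := by
  rw [← ENNReal.ofReal_tsum_of_nonneg (fun n => by positivity) (Real.summable_pow_div_factorial A),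
    Real.exp_eq_exp_ℝ, NormedSpace.exp_eq_tsum_div]

lemma ENNReal.tsum_nat_mul_ofReal_pow_div_factorial {A : ℝ} (hA : 0 ≤ A) :
    ∑' n : ℕ, (n : ℝ≥0∞) * ENNReal.ofReal (A ^ n / n.factorial)
      = ENNReal.ofReal A * ENNReal.ofReal (Real.exp A) := by
  rw [← ENNReal.tsum_ofReal_pow_div_factorial hA, ← ENNReal.tsum_mul_left,
    tsum_eq_zero_add' ENNReal.summable]
  simp only [Nat.cast_zero, zero_mul, zero_add]
  refine tsum_congr fun n => ?_
  rw [← ENNReal.ofReal_natCast, ← ENNReal.ofReal_mul (by positivity), ← ENNReal.ofReal_mul hA]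
  congr 1
  rw [Nat.factorial_succ]
  push_cast
  field_simp
  ring

/-- The sum of `acceptedWeight` over all numbers of points. -/
lemma tsum_acceptedWeight {b : ℝ → ℝ} (hb0 : ∀ v, 0 ≤ b v) {s u : ℝ} (hsu : s ≤ u) :
    ∑' k, acceptedWeight b u k s
      = ENNReal.ofReal (Real.exp (-(u - s)) * Real.exp (∫ v in s..u, b v)) := by
  simp only [acceptedWeight, if_pos hsu, ENNReal.ofReal_mul (Real.exp_pos _).le]
  rw [ENNReal.tsum_mul_left, ENNReal.tsum_ofReal_pow_div_factorial
    (intervalIntegral.integral_nonneg hsu fun v _ => hb0 v)]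

variable {Ω : Type*} [MeasurableSpace Ω]
  {μ : Measure Ω} [IsProbabilityMeasure μ] {P : Measure 𝓧} {X : ℕ → Ω → 𝓧} {G : ℕ → Ω → ℝ}

namespace IsSharedRandomness

variable (H : IsSharedRandomness μ P X G)
include H

/-- The `n`-th marked point, when all preceding points have to be accepted. -/
lemma lintegral_prod_markedPoint_before (n : ℕ) {β : ℝ × 𝓧 → ℝ × 𝓧 → ℝ≥0∞} {b : ℝ × 𝓧 → ℝ → ℝ}
    (hb : IsAcceptance P β b) {f : ℝ × 𝓧 → ℝ≥0∞} (hf : Measurable f) :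
    ∫⁻ ω, (∏ j ∈ Finset.range n, β (markedPoint X G n ω) (markedPoint X G j ω))
        * f (markedPoint X G n ω) ∂μ
      = ∫⁻ t in Set.Ioi 0, ∫⁻ x, acceptedWeight (b (t, x)) t n 0 * f (t, x) ∂P := by
  have hP := H.isProbabilityMeasure
  cases n with
  | zero =>
    simp only [Finset.range_zero, Finset.prod_empty, one_mul]
    rw [H.lintegral_markedPoint_zero hf, expTail]
    refine setLIntegral_congr_fun measurableSet_Ioi fun t ht => ?_
    simp only [acceptedWeight_zero, if_pos (le_of_lt (Set.mem_Ioi.1 ht))]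
    rw [lintegral_const_mul _ (by fun_prop)]
  | succ n =>
    have hprod : ∀ ω z, (∏ j ∈ Finset.range (n + 1), β z (stoppedPoints X G n ω j))
        = ∏ j ∈ Finset.range (n + 1), β z (markedPoint X G j ω) := fun ω z => by
      refine Finset.prod_congr rfl fun j hj => ?_
      rw [stoppedPoints_apply_of_le X G (by have := Finset.mem_range.1 hj; omega)]
    let F : (ℕ → ℝ × 𝓧) × (ℝ × 𝓧) → ℝ≥0∞ := fun p =>
      (∏ j ∈ Finset.range (n + 1), β p.2 (p.1 j)) * f p.2
    have hF : Measurable F := by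
      refine Measurable.mul (Finset.measurable_prod _ fun j _ => ?_) (by fun_prop)
      exact hb.measurable.comp (g := Function.uncurry β) (f := fun p : (ℕ → ℝ × 𝓧) × (ℝ × 𝓧) =>
          (p.2, p.1 j)) (by fun_prop)
    have hGm := H.measurable_G n
    have hSm := H.measurable_stoppedPoints n
    have h1 := H.lintegral_markedPoint_succ n hF
    simp only [F, hprod] at h1
    rw [h1]
    simp_rw [← lintegral_Ioi_acceptedWeight_zero (Real.exp_pos _) fun _ _ => (0 : ℝ)]
    have hm1 : Measurable fun q : (Ω × ℝ) × 𝓧 =>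
        (∏ j ∈ Finset.range (n + 1), β (q.1.2, q.2) (markedPoint X G j q.1.1)) * f (q.1.2, q.2) := by
      refine Measurable.mul (Finset.measurable_prod _ fun j _ => ?_) (by fun_prop)
      have := H.measurable_markedPoint j
      exact hb.measurable.comp (g := Function.uncurry β) (f := fun q : (Ω × ℝ) × 𝓧 =>
          ((q.1.2, q.2), markedPoint X G j q.1.1)) (by fun_prop)
    have hm2 : Measurable fun q : Ω × ℝ => acceptedWeight (fun _ => 0) q.2 0 (Real.exp (-G n q.1)) :=
      measurable_acceptedWeight_zero (fun _ _ => 0) measurable_snd (by fun_prop)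
    rw [lintegral_lintegral_swap (hm2.mul hm1.lintegral_prod_right').aemeasurable]
    refine lintegral_congr fun t => ?_
    have hm1t : Measurable fun q : Ω × 𝓧 => (∏ j ∈ Finset.range (n + 1),
        β (t, q.2) (markedPoint X G j q.1)) * f (t, q.2) :=
      hm1.comp (f := fun q : Ω × 𝓧 => ((q.1, t), q.2)) (by fun_prop)
    have hm2t : Measurable fun ω => acceptedWeight (fun _ => 0) t 0 (Real.exp (-G n ω)) :=
      hm2.comp (f := fun ω => (ω, t)) (by fun_prop)
    have h2 : ∀ ω, acceptedWeight (fun _ => 0) t 0 (Real.exp (-G n ω)) *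
        ∫⁻ x, (∏ j ∈ Finset.range (n + 1), β (t, x) (markedPoint X G j ω)) * f (t, x) ∂P
        = ∫⁻ x, acceptedWeight (fun _ => 0) t 0 (Real.exp (-G n ω)) *
          ((∏ j ∈ Finset.range (n + 1), β (t, x) (markedPoint X G j ω)) * f (t, x)) ∂P := fun ω => by
      rw [lintegral_const_mul]
      exact hm1t.comp (f := fun x => (ω, x)) (by fun_prop)
    simp_rw [h2]
    rw [lintegral_lintegral_swap ((hm2t.comp measurable_fst).mul hm1t).aemeasurable]
    refine lintegral_congr fun x => ?_
    rw [← iterate_stepOp_acceptedWeight (hb.monotone (t, x)) (hb.nonneg (t, x))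
      (hb.lintegral_eq (t, x)), ← H.lintegral_prod_markedPoint n
      (hb.measurable.of_uncurry_left (x := (t, x)))
      (ψ := acceptedWeight (b (t, x)) t 0)
      (measurable_acceptedWeight_zero (fun _ => b (t, x)) measurable_const measurable_id),
      ← lintegral_mul_const]
    · refine lintegral_congr fun ω => ?_
      simp only [acceptedWeight_zero]
      ring
    · refine Measurable.mul (Finset.measurable_prod _ fun j _ => ?_) ?_
      · exact hb.measurable.of_uncurry_left.comp (H.measurable_markedPoint j)
      · exact measurable_acceptedWeight_zero (fun _ => b (t, x)) measurable_const (by fun_prop)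

/-- The intensity of the marked arrival process. -/
lemma tsum_lintegral_markedPoint {f : ℝ × 𝓧 → ℝ≥0∞} (hf : Measurable f) :
    ∑' n, ∫⁻ ω, f (markedPoint X G n ω) ∂μ = ∫⁻ t in Set.Ioi 0, ∫⁻ x, f (t, x) ∂P := by
  have hP := H.isProbabilityMeasure
  -- When every point is accepted, the weights over all `n` are Poisson probabilities with sum `1`,
  -- which leaves Lebesgue measure times `P`.
  have hb : IsAcceptance P (fun _ _ => 1) fun _ _ => 1 :=
    ⟨measurable_const, fun _ => monotone_const, fun _ _ => zero_le_one, by simp⟩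
  have h := fun n => H.lintegral_prod_markedPoint_before n hb hf
  simp only [Finset.prod_const_one, one_mul] at h
  simp_rw [h]
  have hm : ∀ n, Measurable fun z : ℝ × 𝓧 => acceptedWeight (fun _ => 1) z.1 n 0 * f z := fun n =>
    (hb.measurable_acceptedWeight measurable_fst measurable_const n).mul hf
  rw [← lintegral_tsum fun n => (hm n).lintegral_prod_right'.aemeasurable]
  refine setLIntegral_congr_fun measurableSet_Ioi fun t ht => ?_
  simp only
  have hmt : ∀ n, Measurable fun x => acceptedWeight (fun _ => 1) t n 0 * f (t, x) := fun n =>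
    (hm n).comp (measurable_prodMk_left (x := t))
  rw [← lintegral_tsum fun n => (hmt n).aemeasurable]
  refine lintegral_congr fun x => ?_
  rw [ENNReal.tsum_mul_right, tsum_acceptedWeight (fun _ => zero_le_one) (le_of_lt ht),
    ← Real.exp_add]
  simp

/-- The expected number of arrivals up to a fixed time is finite, so almost surely they cannot all
stay below it from some index on. Integer times suffice. -/
lemma ae_exists_lt_arrival : ∀ᵐ ω ∂μ, ∀ u : ℝ, ∀ n : ℕ, ∃ m, n ≤ m ∧ u < Real.exp (-G m ω) := by
  have hP := H.isProbabilityMeasure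
  have h : ∀ u : ℕ, ∀ᵐ ω ∂μ, ∑' n, (if (markedPoint X G n ω).1 ≤ u then (1 : ℝ≥0∞) else 0) < ∞ := by
    intro u
    have hm : Measurable fun z : ℝ × 𝓧 => if z.1 ≤ u then (1 : ℝ≥0∞) else 0 :=
      Measurable.ite (measurableSet_le measurable_fst measurable_const) measurable_const
        measurable_const
    have hmn : ∀ n, Measurable fun ω => if (markedPoint X G n ω).1 ≤ u then (1 : ℝ≥0∞) else 0 :=
      fun n => hm.comp (H.measurable_markedPoint n)
    refine ae_lt_top (Measurable.tsum hmn) ?_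
    rw [lintegral_tsum fun n => (hmn n).aemeasurable, H.tsum_lintegral_markedPoint hm]
    have h1 : ∀ t : ℝ, (if t ≤ (u : ℝ) then (1 : ℝ≥0∞) else 0) = (Set.Iic (u : ℝ)).indicator 1 t :=
      fun t => by simp [Set.indicator]
    simp only [lintegral_const, measure_univ, mul_one, h1]
    rw [setLIntegral_indicator measurableSet_Iic, Set.inter_comm, Set.Ioi_inter_Iic]
    simp
  filter_upwards [ae_all_iff.2 h] with ω hω u n
  by_contra hcon
  push Not at hcon
  obtain ⟨k, hk⟩ := exists_nat_ge u
  refine absurd (hω k) (not_lt.2 (top_le_iff.2 ?_))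
  have h2 : ∀ m, (1 : ℝ≥0∞) ≤ if (markedPoint X G (m + n) ω).1 ≤ k then 1 else 0 := fun m => by
    rw [if_pos]
    exact (hcon _ (by omega)).trans hk
  refine top_le_iff.1 (le_trans ?_ (ENNReal.tsum_comp_le_tsum_of_injective
    (add_left_injective n) _))
  calc (∞ : ℝ≥0∞) = ∑' _ : ℕ, 1 := by simp
    _ ≤ _ := ENNReal.tsum_le_tsum h2

end IsSharedRandomness
end Accept

/-! ### Points after a given one, up to a finite horizon -/

section Future

variable {𝓧 : Type*} [MeasurableSpace 𝓧]

/-- The probability that all points in `(s, u]` are accepted, when points at `v` are accepted with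
probability `b v`. -/
noncomputable def allAccepted (b : ℝ → ℝ) (u s : ℝ) : ℝ≥0∞ := ∑' k, acceptedWeight b u k s

lemma allAccepted_eq {b : ℝ → ℝ} (hb0 : ∀ v, 0 ≤ b v) {s u : ℝ} (hsu : s ≤ u) :
    allAccepted b u s = ENNReal.ofReal (Real.exp (-(u - s)) * Real.exp (∫ v in s..u, b v)) :=
  tsum_acceptedWeight hb0 hsu

lemma IsAcceptance.measurable_allAccepted {P : Measure 𝓧} [SFinite P]
    {β : ℝ × 𝓧 → ℝ × 𝓧 → ℝ≥0∞} {b : ℝ × 𝓧 → ℝ → ℝ} (hb : IsAcceptance P β b)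
    {u s : ℝ × 𝓧 → ℝ} (hu : Measurable u) (hs : Measurable s) :
    Measurable fun z => allAccepted (b z) (u z) (s z) :=
  Measurable.tsum fun k => hb.measurable_acceptedWeight hu hs k

variable {Ω : Type*} [MeasurableSpace Ω]
  {μ : Measure Ω} [IsProbabilityMeasure μ] {P : Measure 𝓧} {X : ℕ → Ω → 𝓧} {G : ℕ → Ω → ℝ}

namespace IsSharedRandomness

variable (H : IsSharedRandomness μ P X G)
include H

/-- The two indicators say that exactly `m` arrivals follow the `n`-th one before the horizon `u`.
Integrating out the arrival beyond `u` leaves the weight with no accepted points, from which the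
iterates start. -/
lemma lintegral_prod_markedPoint_between (n m : ℕ) {β : ℝ × 𝓧 → ℝ × 𝓧 → ℝ≥0∞} {b : ℝ × 𝓧 → ℝ → ℝ}
    (hb : IsAcceptance P β b) {h : (ℕ → ℝ × 𝓧) → ℝ≥0∞} (hh : Measurable h) (u : ℝ) :
    ∫⁻ ω, h (stoppedPoints X G n ω) * ((∏ j ∈ Finset.range m,
        β (markedPoint X G n ω) (markedPoint X G (n + 1 + j) ω)) *
        ((Set.Iic u).indicator (fun _ => 1) (Real.exp (-G (n + m) ω)) *
          (Set.Ioi u).indicator (fun _ => 1) (Real.exp (-G (n + m + 1) ω)))) ∂μ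
      = ∫⁻ ω, h (stoppedPoints X G n ω) *
          acceptedWeight (b (markedPoint X G n ω)) u m (Real.exp (-G n ω)) ∂μ := by
  have hP := H.isProbabilityMeasure
  let τ : (ℕ → ℝ × 𝓧) → (ℕ → ℝ × 𝓧) := fun s i => s (min i n)
  have hτ : Measurable τ := measurable_pi_iff.2 fun i => measurable_pi_apply _
  have hτω : ∀ ω, τ (stoppedPoints X G (n + m) ω) = stoppedPoints X G n ω := fun ω => by
    ext1 i
    simp only [τ, stoppedPoints]
    congr 1
    omega
  let F : (ℕ → ℝ × 𝓧) × (ℝ × 𝓧) → ℝ≥0∞ := fun p =>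
    (h (τ p.1) * ((∏ j ∈ Finset.range m, β (p.1 n) (p.1 (n + 1 + j))) *
        (Set.Iic u).indicator (fun _ => 1) (p.1 (n + m)).1)) * (Set.Ioi u).indicator (fun _ => 1) p.2.1
  have hF : Measurable F := by
    refine Measurable.mul (Measurable.mul (by fun_prop)
      (Measurable.mul (Finset.measurable_prod _ fun j _ => ?_) ?_)) ?_
    · exact hb.measurable.comp (g := Function.uncurry β) (f := fun p : (ℕ → ℝ × 𝓧) × (ℝ × 𝓧) =>
        (p.1 n, p.1 (n + 1 + j))) (by fun_prop)
    · exact (measurable_const.indicator measurableSet_Iic).comp (by fun_prop)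
    · exact (measurable_const.indicator measurableSet_Ioi).comp (by fun_prop)
  have hprod : ∀ ω, (∏ j ∈ Finset.range m, β (markedPoint X G n ω)
      (stoppedPoints X G (n + m) ω (n + 1 + j))) = ∏ j ∈ Finset.range m,
        β (markedPoint X G n ω) (markedPoint X G (n + 1 + j) ω) := fun ω => by
    refine Finset.prod_congr rfl fun j hj => ?_
    rw [stoppedPoints_apply_of_le X G (by have := Finset.mem_range.1 hj; omega)]
  have hn : ∀ ω, stoppedPoints X G (n + m) ω n = markedPoint X G n ω := fun ω =>
    stoppedPoints_apply_of_le X G (by omega) ω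
  have hnm : ∀ ω, stoppedPoints X G (n + m) ω (n + m) = markedPoint X G (n + m) ω := fun ω =>
    stoppedPoints_apply_of_le X G le_rfl ω
  have hnn : ∀ ω, stoppedPoints X G n ω n = markedPoint X G n ω := fun ω =>
    stoppedPoints_apply_of_le X G le_rfl ω
  have hψm : Measurable (Function.uncurry fun (e : ℕ → ℝ × 𝓧) t =>
      h e * acceptedWeight (b (e n)) u 0 t) :=
    (hh.comp measurable_fst).mul (measurable_acceptedWeight_zero
      (E := (ℕ → ℝ × 𝓧) × ℝ) (fun p => b (p.1 n)) measurable_const measurable_snd)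
  have hβm : Measurable (Function.uncurry fun (e : ℕ → ℝ × 𝓧) => β (e n)) :=
    hb.measurable.comp (g := Function.uncurry β) (f := fun p : (ℕ → ℝ × 𝓧) × (ℝ × 𝓧) =>
        (p.1 n, p.2)) (by fun_prop)
  calc _ = ∫⁻ ω, F (stoppedPoints X G (n + m) ω, markedPoint X G (n + m + 1) ω) ∂μ := by
        refine lintegral_congr fun ω => ?_
        simp only [F, hτω, hprod, hn, hnm, mul_assoc]
        rfl
    _ = ∫⁻ ω, (∏ j ∈ Finset.range m, β (stoppedPoints X G n ω n)
          (markedPoint X G (n + 1 + j) ω)) * (h (stoppedPoints X G n ω) *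
          acceptedWeight (b (stoppedPoints X G n ω n)) u 0 (Real.exp (-G (n + m) ω))) ∂μ := by
        rw [H.lintegral_markedPoint_succ (n + m) hF]
        refine lintegral_congr fun ω => ?_
        simp only [F, hτω, hprod, hn, hnm, hnn, lintegral_const, measure_univ, mul_one]
        rw [expTail_const_mul _ _ (measurable_const.indicator measurableSet_Ioi),
          acceptedWeight_zero]
        by_cases hu : Real.exp (-G (n + m) ω) ≤ u
        · rw [expTail_indicator_Ioi hu, if_pos hu]
          simp only [markedPoint, Set.indicator_of_mem (s := Set.Iic u) hu]
          ring
        · simp [markedPoint, hu]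
    _ = _ := by
        rw [H.lintegral_prod_markedPoint_after n m (β := fun e => β (e n))
          (ψ := fun e t => h e * acceptedWeight (b (e n)) u 0 t) hβm hψm]
        refine lintegral_congr fun ω => ?_
        rw [iterate_stepOp_const_mul hb.measurable.of_uncurry_left
          (ψ := acceptedWeight (b (stoppedPoints X G n ω n)) u 0)
          (measurable_acceptedWeight_zero (E := ℝ) (fun _ => b _) measurable_const measurable_id),
          iterate_stepOp_acceptedWeight (hb.monotone _) (hb.nonneg _) (hb.lintegral_eq _), hnn]

lemma lintegral_forall_accepted_le (n : ℕ) {β : ℝ × 𝓧 → ℝ × 𝓧 → ℝ≥0∞} {b : ℝ × 𝓧 → ℝ → ℝ}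
    (hb : IsAcceptance P β b) {h : (ℕ → ℝ × 𝓧) → ℝ≥0∞} (hh : Measurable h) (u : ℝ) :
    ∫⁻ ω, h (stoppedPoints X G n ω) *
        {ω | (∀ j, n < j → β (markedPoint X G n ω) (markedPoint X G j ω) = 1) ∧
          Real.exp (-G n ω) ≤ u}.indicator 1 ω ∂μ
      ≤ ∫⁻ ω, h (stoppedPoints X G n ω) *
          allAccepted (b (markedPoint X G n ω)) u (Real.exp (-G n ω)) ∂μ := by
  have hP := H.isProbabilityMeasure
  have hsn := H.measurable_stoppedPoints n
  have hGm := H.measurable_G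
  have hm : ∀ m, Measurable fun ω => h (stoppedPoints X G n ω) *
          acceptedWeight (b (markedPoint X G n ω)) u m (Real.exp (-G n ω)) := fun m =>
    (hh.comp hsn).mul ((hb.measurable_acceptedWeight (u := fun _ => u) (s := fun z => z.1)
      measurable_const measurable_fst m).comp (H.measurable_markedPoint n))
  have hm' : ∀ m, Measurable fun ω => h (stoppedPoints X G n ω) * ((∏ j ∈ Finset.range m,
        β (markedPoint X G n ω) (markedPoint X G (n + 1 + j) ω)) *
        ((Set.Iic u).indicator (fun _ => 1) (Real.exp (-G (n + m) ω)) *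
          (Set.Ioi u).indicator (fun _ => 1) (Real.exp (-G (n + m + 1) ω)))) := fun m => by
    refine (hh.comp hsn).mul (Measurable.mul (Finset.measurable_prod _ fun j _ => ?_)
      (Measurable.mul ?_ ?_))
    · exact hb.measurable.comp (g := Function.uncurry β)
        ((H.measurable_markedPoint n).prodMk (H.measurable_markedPoint _))
    · exact (measurable_const.indicator measurableSet_Iic).comp (by fun_prop)
    · exact (measurable_const.indicator measurableSet_Ioi).comp (by fun_prop)
  simp only [allAccepted, ← ENNReal.tsum_mul_left]
  rw [lintegral_tsum fun m => (hm m).aemeasurable]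
  simp_rw [← H.lintegral_prod_markedPoint_between n _ hb hh u]
  rw [← lintegral_tsum fun m => (hm' m).aemeasurable]
  refine lintegral_mono_ae ?_
  filter_upwards [H.ae_exists_lt_arrival] with ω hω
  rw [ENNReal.tsum_mul_left]
  gcongr
  by_cases hS : (∀ j, n < j → β (markedPoint X G n ω) (markedPoint X G j ω) = 1) ∧
      Real.exp (-G n ω) ≤ u
  · have hex : ∃ m, u < Real.exp (-G (n + m) ω) := by
      obtain ⟨m, hm, hu⟩ := hω u n
      exact ⟨m - n, by rwa [Nat.add_sub_cancel' hm]⟩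
    classical
    -- The first index past the horizon has a predecessor, since the `n`-th point itself lies before
    -- `u`; that predecessor selects the term of the sum that dominates the indicator.
    have h0 : Nat.find hex ≠ 0 := fun h0 => by
      have := Nat.find_spec hex
      rw [h0] at this
      exact absurd hS.2 (not_le.2 this)
    obtain ⟨m, hm⟩ := Nat.exists_eq_succ_of_ne_zero h0
    have h1 := Nat.find_spec hex
    have h2 := Nat.find_min hex (m := m) (by omega)
    rw [hm, ← Nat.add_one, ← add_assoc] at h1
    refine le_trans ?_ (ENNReal.le_tsum m)
    rw [Finset.prod_congr rfl fun j _ => hS.1 (n + 1 + j) (by omega),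
      Set.indicator_of_mem (s := Set.Iic u) (not_lt.1 h2),
      Set.indicator_of_mem (s := Set.Ioi u) h1, Set.indicator_of_mem (by exact hS)]
    simp
  · rw [Set.indicator_of_notMem (by exact hS)]
    exact zero_le

end IsSharedRandomness
end Future

/-! ### Combining past and future of a point -/

section Truncated

variable {𝓧 : Type*} [MeasurableSpace 𝓧]

/-- Up to normalisation the weights are Poisson with parameter `∫ v in s..u, b v`, so the factor `n`
averages to that parameter. -/
lemma tsum_acceptedWeight_mul {b : ℝ → ℝ} (hb0 : ∀ v, 0 ≤ b v) {s u : ℝ} (hsu : s ≤ u)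
    (a d : ℝ≥0∞) : ∑' n : ℕ, acceptedWeight b u n s * (a + n * d)
      = (a + ENNReal.ofReal (∫ v in s..u, b v) * d) * allAccepted b u s := by
  have h0 := intervalIntegral.integral_nonneg (μ := volume) hsu fun v _ => hb0 v
  have h1 : ∀ n : ℕ, acceptedWeight b u n s * (a + n * d)
      = ENNReal.ofReal (Real.exp (-(u - s))) *
        (ENNReal.ofReal ((∫ v in s..u, b v) ^ n / n.factorial) * a
          + n * ENNReal.ofReal ((∫ v in s..u, b v) ^ n / n.factorial) * d) := fun n => by
    rw [acceptedWeight, if_pos hsu, ENNReal.ofReal_mul (Real.exp_pos _).le]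
    ring
  simp_rw [h1]
  rw [ENNReal.tsum_mul_left, ENNReal.tsum_add, ENNReal.tsum_mul_right, ENNReal.tsum_mul_right,
    ENNReal.tsum_ofReal_pow_div_factorial h0, ENNReal.tsum_nat_mul_ofReal_pow_div_factorial h0,
    allAccepted_eq hb0 hsu, ENNReal.ofReal_mul (Real.exp_pos _).le]
  ring

/-- Past and future join at `t` into the void probability of the rejected points, which arrive at
rate `1 - b v`. -/
lemma allAccepted_mul_allAccepted {b : ℝ → ℝ} (hb : Monotone b) (hb0 : ∀ v, 0 ≤ b v) {t u : ℝ}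
    (ht : 0 ≤ t) (htu : t ≤ u) : allAccepted b t 0 * allAccepted b u t
      = ENNReal.ofReal (Real.exp (-∫ v in 0..u, (1 - b v))) := by
  have hi : ∀ a c, IntervalIntegrable b volume a c := fun a c => hb.intervalIntegrable
  rw [allAccepted_eq hb0 ht, allAccepted_eq hb0 htu, ← ENNReal.ofReal_mul (by positivity),
    ← Real.exp_add, ← Real.exp_add, ← Real.exp_add,
    intervalIntegral.integral_sub (by simp) (hi _ _),
    ← intervalIntegral.integral_add_adjacent_intervals (hi 0 t) (hi t u)]
  congr 2
  simp
  ring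

variable {Ω : Type*} [MeasurableSpace Ω]
  {μ : Measure Ω} [IsProbabilityMeasure μ] {P : Measure 𝓧} {X : ℕ → Ω → 𝓧} {G : ℕ → Ω → ℝ}

namespace IsSharedRandomness

variable (H : IsSharedRandomness μ P X G)
include H

lemma tsum_lintegral_forall_accepted_le {β : ℝ × 𝓧 → ℝ × 𝓧 → ℝ≥0∞} {b : ℝ × 𝓧 → ℝ → ℝ}
    (hb : IsAcceptance P β b) (hb1 : ∀ z v, b z v ≤ 1) {a d : 𝓧 → ℝ≥0∞} (ha : Measurable a)
    (hd : Measurable d) {w u : ℝ} (hwu : w ≤ u) :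
    ∑' n : ℕ, ∫⁻ ω, (a (X n ω) + n * d (X n ω)) *
        {ω | (∀ j, j ≠ n → β (markedPoint X G n ω) (markedPoint X G j ω) = 1) ∧
          Real.exp (-G n ω) ≤ w}.indicator 1 ω ∂μ
      ≤ ∫⁻ t in Set.Ioc 0 w, ∫⁻ x, (a x + ENNReal.ofReal t * d x) *
          (allAccepted (b (t, x)) t 0 * allAccepted (b (t, x)) u t) ∂P := by
  have hP := H.isProbabilityMeasure
  let f : ℕ → ℝ × 𝓧 → ℝ≥0∞ := fun n z =>
    (a z.2 + n * d z.2) * ((Set.Iic w).indicator (fun _ => 1) z.1 * allAccepted (b z) u z.1)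
  have hind : Measurable fun z : ℝ × 𝓧 => (Set.Iic w).indicator (fun _ => (1 : ℝ≥0∞)) z.1 :=
    (measurable_const.indicator measurableSet_Iic).comp measurable_fst
  have hf : ∀ n, Measurable (f n) := fun n =>
    (by fun_prop : Measurable fun z : ℝ × 𝓧 => a z.2 + n * d z.2).mul
      (hind.mul (hb.measurable_allAccepted measurable_const measurable_fst))
  have hstep : ∀ n : ℕ, ∫⁻ ω, (a (X n ω) + n * d (X n ω)) *
        {ω | (∀ j, j ≠ n → β (markedPoint X G n ω) (markedPoint X G j ω) = 1) ∧
          Real.exp (-G n ω) ≤ w}.indicator 1 ω ∂μ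
      ≤ ∫⁻ t in Set.Ioi 0, ∫⁻ x, acceptedWeight (b (t, x)) t n 0 * f n (t, x) ∂P := by
    intro n
    let h : (ℕ → ℝ × 𝓧) → ℝ≥0∞ := fun s => (∏ j ∈ Finset.range n, β (s n) (s j)) *
      ((a (s n).2 + n * d (s n).2) * (Set.Iic w).indicator (fun _ => 1) (s n).1)
    have hh : Measurable h := by
      refine Measurable.mul (Finset.measurable_prod _ fun j _ => ?_) (Measurable.mul ?_ ?_)
      · exact hb.measurable.comp (g := Function.uncurry β) (f := fun s : ℕ → ℝ × 𝓧 => (s n, s j))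
          (by fun_prop)
      · fun_prop
      · exact hind.comp (measurable_pi_apply n)
    have hnn : ∀ ω, stoppedPoints X G n ω n = markedPoint X G n ω := fun ω =>
      stoppedPoints_apply_of_le X G le_rfl ω
    have hprod : ∀ ω, (∏ j ∈ Finset.range n, β (markedPoint X G n ω) (stoppedPoints X G n ω j))
        = ∏ j ∈ Finset.range n, β (markedPoint X G n ω) (markedPoint X G j ω) := fun ω => by
      refine Finset.prod_congr rfl fun j hj => ?_
      rw [stoppedPoints_apply_of_le X G (Finset.mem_range.1 hj).le]
    rw [← H.lintegral_prod_markedPoint_before n hb (hf n)]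
    refine le_trans (lintegral_mono fun ω => ?_)
      ((H.lintegral_forall_accepted_le n hb hh u).trans (le_of_eq (lintegral_congr fun ω => ?_)))
    · by_cases hS : (∀ j, j ≠ n → β (markedPoint X G n ω) (markedPoint X G j ω) = 1) ∧
          Real.exp (-G n ω) ≤ w
      · simp only [h, hnn, hprod]
        rw [Finset.prod_congr rfl fun j hj => hS.1 j (Finset.mem_range.1 hj).ne,
          Set.indicator_of_mem (s := Set.Iic w) (show (markedPoint X G n ω).1 ∈ Set.Iic w from hS.2),
          Set.indicator_of_mem (by exact hS),
          Set.indicator_of_mem (by exact ⟨fun j hj => hS.1 j (ne_of_gt hj), hS.2.trans hwu⟩)]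
        simp [markedPoint]
      · rw [Set.indicator_of_notMem (by exact hS), mul_zero]
        exact zero_le
    · simp only [h, hnn, hprod, f, mul_assoc]
      rfl
  have hm : ∀ n, Measurable fun z : ℝ × 𝓧 => acceptedWeight (b z) z.1 n 0 * f n z := fun n =>
    (hb.measurable_acceptedWeight measurable_fst measurable_const n).mul (hf n)
  refine (ENNReal.tsum_le_tsum hstep).trans ?_
  rw [← lintegral_tsum fun n => (hm n).lintegral_prod_right'.aemeasurable]
  rw [← Set.Ioi_inter_Iic, Set.inter_comm, ← setLIntegral_indicator measurableSet_Iic]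
  refine setLIntegral_mono' measurableSet_Ioi fun t ht => ?_
  have ht0 : 0 ≤ t := le_of_lt ht
  have hmt : ∀ n, Measurable fun x => acceptedWeight (b (t, x)) t n 0 * f n (t, x) := fun n =>
    (hm n).comp (measurable_prodMk_left (x := t))
  rw [← lintegral_tsum fun n => (hmt n).aemeasurable]
  by_cases htw : t ≤ w
  · rw [Set.indicator_of_mem (s := Set.Iic w) htw]
    refine lintegral_mono fun x => ?_
    simp only [f, Set.indicator_of_mem (s := Set.Iic w) htw, one_mul]
    simp_rw [← mul_assoc]
    rw [ENNReal.tsum_mul_right, tsum_acceptedWeight_mul (hb.nonneg _) ht0]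
    gcongr
    -- The mean number of accepted earlier points is replaced by the mean number `t` of all earlier
    -- points.
    calc ∫ v in 0..t, b (t, x) v ≤ ∫ _ in 0..t, (1 : ℝ) :=
          intervalIntegral.integral_mono_on ht0 ((hb.monotone _).intervalIntegrable) (by simp)
            fun v _ => hb1 _ v
      _ = t := by simp
  · simp [f, Set.indicator_of_notMem (s := Set.Iic w) htw]

end IsSharedRandomness
end Truncated

/-! ### The probability that a point is never beaten -/

section Density

variable {𝓧 : Type*} [MeasurableSpace 𝓧]

/-- The indicator that the marked point `z'` does not beat the marked point `z`. -/
noncomputable def notBeaten (r : 𝓧 → ℝ≥0∞) (z z' : ℝ × 𝓧) : ℝ≥0∞ :=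
  {p : (ℝ × 𝓧) × (ℝ × 𝓧) | r p.2.2 * ENNReal.ofReal p.1.1 ≤ r p.1.2 * ENNReal.ofReal p.2.1}.indicator
    1 (z, z')

/-- The probability that a point at `v` does not beat the marked point `z`. -/
noncomputable def notBeatenProb (P : Measure 𝓧) (r : 𝓧 → ℝ≥0∞) (z : ℝ × 𝓧) (v : ℝ) : ℝ :=
  P.real {x | r x * ENNReal.ofReal z.1 ≤ r z.2 * ENNReal.ofReal v}

lemma isAcceptance_notBeaten {P : Measure 𝓧} [IsProbabilityMeasure P] {r : 𝓧 → ℝ≥0∞}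
    (hr : Measurable r) : IsAcceptance P (notBeaten r) (notBeatenProb P r) where
  measurable := measurable_one.indicator (measurableSet_le (by fun_prop) (by fun_prop))
  monotone z v v' hv := by
    refine measureReal_mono fun x hx => ?_
    have hx : r x * ENNReal.ofReal z.1 ≤ r z.2 * ENNReal.ofReal v := hx
    exact hx.trans (mul_le_mul' le_rfl (ENNReal.ofReal_le_ofReal hv))
  nonneg z v := measureReal_nonneg
  lintegral_eq z v := by
    have hm : MeasurableSet {x | r x * ENNReal.ofReal z.1 ≤ r z.2 * ENNReal.ofReal v} :=
      measurableSet_le (by fun_prop) (by fun_prop)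
    rw [notBeatenProb, ofReal_measureReal, ← lintegral_indicator_one hm]
    rfl

lemma volume_Ioi_inter_ofReal_lt (c : ℝ≥0∞) :
    volume (Set.Ioi 0 ∩ {v : ℝ | ENNReal.ofReal v < c}) = c := by
  by_cases hc : c = ∞
  · subst hc
    simp
  · have : Set.Ioi 0 ∩ {v : ℝ | ENNReal.ofReal v < c} = Set.Ioo 0 c.toReal := by
      ext v
      simp only [Set.mem_inter_iff, Set.mem_Ioi, Set.mem_ofPred_eq, Set.mem_Ioo]
      exact and_congr_right fun hv => ENNReal.ofReal_lt_iff_lt_toReal (le_of_lt hv) hc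
    rw [this, Real.volume_Ioo, sub_zero, ENNReal.ofReal_toReal hc]

/-- The layer cake formula for the number of points above a level. -/
lemma lintegral_Ioi_measure_mul_lt {P : Measure 𝓧} [SFinite P] {f : 𝓧 → ℝ≥0∞} (hf : Measurable f)
    {c : ℝ≥0∞} (hc0 : c ≠ 0) (hc : c ≠ ∞) :
    ∫⁻ v in Set.Ioi 0, P {x | c * ENNReal.ofReal v < f x} = (∫⁻ x, f x ∂P) / c := by
  have hm : MeasurableSet {p : ℝ × 𝓧 | c * ENNReal.ofReal p.1 < f p.2} :=
    measurableSet_lt (by fun_prop) (by fun_prop)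
  have h1 := Measure.prod_apply (μ := volume.restrict (Set.Ioi (0 : ℝ))) (ν := P) hm
  have h2 := Measure.prod_apply_symm (μ := volume.restrict (Set.Ioi (0 : ℝ))) (ν := P) hm
  calc _ = _ := h1.symm
    _ = _ := h2
    _ = ∫⁻ x, f x / c ∂P := by
      refine lintegral_congr fun x => ?_
      have : (fun v : ℝ => (v, x)) ⁻¹' {p : ℝ × 𝓧 | c * ENNReal.ofReal p.1 < f p.2}
          = {v : ℝ | ENNReal.ofReal v < f x / c} := by
        ext v
        simp only [Set.mem_preimage, Set.mem_ofPred_eq]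
        rw [ENNReal.lt_div_iff_mul_lt (Or.inl hc0) (Or.inl hc), mul_comm]
      rw [this, Measure.restrict_apply (measurableSet_lt (by fun_prop) measurable_const),
        Set.inter_comm, volume_Ioi_inter_ofReal_lt]
    _ = _ := by simp_rw [div_eq_mul_inv]; rw [lintegral_mul_const _ hf]

lemma one_sub_notBeatenProb {P : Measure 𝓧} [IsProbabilityMeasure P] {r : 𝓧 → ℝ≥0∞}
    (hr : Measurable r) (z : ℝ × 𝓧) (v : ℝ) : 1 - notBeatenProb P r z v
      = P.real {x | r z.2 * ENNReal.ofReal v < r x * ENNReal.ofReal z.1} := by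
  have hm : MeasurableSet {x | r x * ENNReal.ofReal z.1 ≤ r z.2 * ENNReal.ofReal v} :=
    measurableSet_le (by fun_prop) (by fun_prop)
  rw [notBeatenProb, ← probReal_compl_eq_one_sub hm]
  congr 1
  ext x
  simp

/-- The limit of the probability that no point beats a given marked point. -/
noncomputable def neverBeatenProb (r : 𝓧 → ℝ≥0∞) (z : ℝ × 𝓧) : ℝ≥0∞ :=
  if r z.2 = 0 then 0 else ENNReal.ofReal (Real.exp (-(z.1 / (r z.2).toReal)))

/-- By the layer cake formula, the expected number of points beating `z` is `z.1 / r z.2`, since `r`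
integrates to `1`. If `r z.2 = 0`, points of positive density beat `z` at a constant positive rate,
and the limit is `0`. -/
lemma tendsto_neverBeatenProb {P : Measure 𝓧} [IsProbabilityMeasure P] {r : 𝓧 → ℝ≥0∞}
    (hr : Measurable r) (hr1 : ∫⁻ x, r x ∂P = 1) {z : ℝ × 𝓧} (hz : 0 < z.1) (hz' : r z.2 ≠ ∞) :
    Filter.Tendsto (fun u : ℝ => ENNReal.ofReal
      (Real.exp (-∫ v in 0..u, (1 - notBeatenProb P r z v)))) Filter.atTop
      (nhds (neverBeatenProb r z)) := by
  have hz0 : ENNReal.ofReal z.1 ≠ 0 := by simpa using hz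
  rw [neverBeatenProb]
  split_ifs with h0
  · have hpos : 0 < P.real {x | 0 < r x * ENNReal.ofReal z.1} := by
      refine (measureReal_nonneg).lt_of_ne' fun h => ?_
      rw [measureReal_eq_zero_iff] at h
      have : ∫⁻ x, r x ∂P = 0 := by
        rw [lintegral_eq_zero_iff hr]
        refine measure_mono_null (fun x hx => ?_) h
        exact ENNReal.mul_pos hx hz0
      simp [this] at hr1
    simp only [one_sub_notBeatenProb hr, h0, zero_mul, intervalIntegral.integral_const, sub_zero,
      smul_eq_mul]
    have h := ENNReal.tendsto_ofReal (Real.tendsto_exp_atBot.comp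
      (Filter.tendsto_neg_atTop_atBot.comp (Filter.tendsto_id.atTop_mul_const hpos)))
    rwa [ENNReal.ofReal_zero] at h
  · have hanti : Antitone fun v => 1 - notBeatenProb P r z v := fun v v' hv =>
      sub_le_sub_left ((isAcceptance_notBeaten hr).monotone z hv) _
    have hlint : ∫⁻ v in Set.Ioi 0, ENNReal.ofReal (1 - notBeatenProb P r z v)
        = ENNReal.ofReal z.1 / r z.2 := by
      have h : ∀ v, ENNReal.ofReal (1 - notBeatenProb P r z v)
          = P {x | r z.2 * ENNReal.ofReal v < r x * ENNReal.ofReal z.1} := fun v => by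
        rw [one_sub_notBeatenProb hr, ofReal_measureReal]
      simp_rw [h]
      rw [lintegral_Ioi_measure_mul_lt (f := fun x => r x * ENNReal.ofReal z.1) (by fun_prop) h0 hz',
        lintegral_mul_const _ hr, hr1, one_mul]
    have hnn : ∀ v, 0 ≤ 1 - notBeatenProb P r z v := fun v => by
      rw [one_sub_notBeatenProb hr]
      exact measureReal_nonneg
    have hint : IntegrableOn (fun v => 1 - notBeatenProb P r z v) (Set.Ioi 0) := by
      refine (lintegral_ofReal_ne_top_iff_integrable hanti.measurable.aestronglyMeasurable
        (ae_of_all _ hnn)).1 ?_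
      rw [hlint]
      exact ENNReal.div_ne_top ENNReal.ofReal_ne_top h0
    have hval : ∫ v in Set.Ioi 0, (1 - notBeatenProb P r z v) = z.1 / (r z.2).toReal := by
      rw [integral_eq_lintegral_of_nonneg_ae (ae_of_all _ hnn)
        hanti.measurable.aestronglyMeasurable, hlint, ENNReal.toReal_div,
        ENNReal.toReal_ofReal hz.le]
    rw [← hval]
    refine ENNReal.tendsto_ofReal ((Real.continuous_exp.tendsto _).comp ?_)
    exact (intervalIntegral_tendsto_integral_Ioi 0 hint Filter.tendsto_id).neg

omit [MeasurableSpace 𝓧] in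
-- These are the integrals of `1` and `t` against `exp (-t / ρ)`, with `ρ = r x`: namely `ρ` and
-- `ρ²`.
lemma lintegral_Ioi_neverBeatenProb {r : 𝓧 → ℝ≥0∞} {x : 𝓧} (hx : r x ≠ ∞) (a d : ℝ≥0∞) :
    ∫⁻ t in Set.Ioi 0, (a + ENNReal.ofReal t * d) * neverBeatenProb r (t, x)
      = a * r x + d * r x ^ 2 := by
  simp only [neverBeatenProb]
  split_ifs with h0
  · simp [h0]
  · set ρ := (r x).toReal with hρ
    have hρ0 : 0 < ρ := ENNReal.toReal_pos h0 hx
    have hrx : r x = ENNReal.ofReal ρ := (ENNReal.ofReal_toReal hx).symm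
    have h1 : ∫⁻ t in Set.Ioi (0 : ℝ), ENNReal.ofReal (Real.exp (-(t / ρ))) = r x := by
      have hi : IntegrableOn (fun t : ℝ => Real.exp (-(t / ρ))) (Set.Ioi 0) := by
        have := integrableOn_exp_mul_Ioi (a := -(1 / ρ)) (by simpa using hρ0) 0
        refine this.congr_fun (fun t _ => ?_) measurableSet_Ioi
        simp only
        congr 1
        ring
      rw [← ofReal_integral_eq_lintegral_ofReal hi (ae_of_all _ fun _ => (Real.exp_pos _).le), hrx]
      congr 1
      have := integral_exp_mul_Ioi (a := -(1 / ρ)) (by simpa using hρ0) 0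
      calc _ = ∫ t in Set.Ioi (0 : ℝ), Real.exp (-(1 / ρ) * t) := by
            congr 1 with t
            congr 1
            ring
        _ = ρ := by rw [this]; simp
    have h2 : ∫⁻ t in Set.Ioi (0 : ℝ), ENNReal.ofReal t * ENNReal.ofReal (Real.exp (-(t / ρ)))
        = r x ^ 2 := by
      have hg := Real.integral_rpow_mul_exp_neg_mul_Ioi (a := 2) (r := 1 / ρ) (by norm_num)
        (by positivity)
      have he : ∀ t : ℝ, t ^ ((2 : ℝ) - 1) * Real.exp (-(1 / ρ * t)) = t * Real.exp (-(t / ρ)) := by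
        intro t
        norm_num
        left
        ring
      simp_rw [he] at hg
      have hg' : ∫ t in Set.Ioi (0 : ℝ), t * Real.exp (-(t / ρ)) = ρ ^ 2 := by
        rw [hg, show (2 : ℝ) = (1 : ℕ) + 1 by norm_num, Real.Gamma_nat_eq_factorial]
        simp
        norm_cast
      -- A non-integrable function has Bochner integral `0` by convention, so the nonzero value just
      -- found forces integrability.
      have hi : IntegrableOn (fun t : ℝ => t * Real.exp (-(t / ρ))) (Set.Ioi 0) :=
        not_not.1 fun h => (pow_pos hρ0 2).ne' (hg'.symm.trans (integral_undef h))
      calc _ = ∫⁻ t in Set.Ioi (0 : ℝ), ENNReal.ofReal (t * Real.exp (-(t / ρ))) := by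
            refine setLIntegral_congr_fun measurableSet_Ioi fun t ht => ?_
            rw [ENNReal.ofReal_mul (le_of_lt ht)]
        _ = _ := by
          rw [← ofReal_integral_eq_lintegral_ofReal hi, hg', hrx, ENNReal.ofReal_pow hρ0.le]
          filter_upwards [ae_restrict_mem measurableSet_Ioi] with t ht
          have : (0 : ℝ) < t := ht
          positivity
    calc _ = ∫⁻ t in Set.Ioi 0, (a * ENNReal.ofReal (Real.exp (-(t / ρ)))
          + d * (ENNReal.ofReal t * ENNReal.ofReal (Real.exp (-(t / ρ))))) :=
          lintegral_congr fun t => by ring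
      _ = _ := by
        rw [lintegral_add_left (by fun_prop), lintegral_const_mul _ (by fun_prop),
          lintegral_const_mul _ (by fun_prop), h1, h2]

end Density

/-! ### Functionals of the maximiser, and its existence -/

section Maximiser

variable {𝓧 : Type*} [MeasurableSpace 𝓧]

lemma measurable_neverBeatenProb {r : 𝓧 → ℝ≥0∞} (hr : Measurable r) :
    Measurable (neverBeatenProb r) := by
  unfold neverBeatenProb
  exact Measurable.ite (measurableSet_eq_fun (by fun_prop) (by fun_prop)) measurable_const
    (by fun_prop)

variable {Ω : Type*} [MeasurableSpace Ω]
  {μ : Measure Ω} [IsProbabilityMeasure μ] {P : Measure 𝓧} {X : ℕ → Ω → 𝓧} {G : ℕ → Ω → ℝ}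

/-- The event that the `n`-th candidate is not beaten by any other. -/
def isMaxEvent (r : 𝓧 → ℝ≥0∞) (X : ℕ → Ω → 𝓧) (G : ℕ → Ω → ℝ) (n : ℕ) : Set Ω :=
  {ω | ∀ j, r (X j ω) * ENNReal.ofReal (Real.exp (-G n ω))
    ≤ r (X n ω) * ENNReal.ofReal (Real.exp (-G j ω))}

namespace IsSharedRandomness

variable (H : IsSharedRandomness μ P X G)
include H

/-- Being maximal implies not being beaten before the horizon `w + n`, for every `n`. The left side
does not involve the horizon, so it can be sent to infinity on the right; the cutoff `w` on the
arrival time makes the integrands dominated. -/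
lemma tsum_lintegral_isMaxEvent_le {r : 𝓧 → ℝ≥0∞} (hr : Measurable r) (hr1 : ∫⁻ x, r x ∂P = 1)
    {a d : 𝓧 → ℝ≥0∞} (ha : Measurable a) (hd : Measurable d) (ha' : ∫⁻ x, a x ∂P ≠ ∞)
    (hd' : ∫⁻ x, d x ∂P ≠ ∞) {w : ℝ} :
    ∑' n : ℕ, ∫⁻ ω, (a (X n ω) + n * d (X n ω)) *
        (isMaxEvent r X G n ∩ {ω | Real.exp (-G n ω) ≤ w}).indicator 1 ω ∂μ
      ≤ ∫⁻ x, (a x * r x + d x * r x ^ 2) ∂P := by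
  have hP := H.isProbabilityMeasure
  have hb := isAcceptance_notBeaten (P := P) hr
  have hb1 : ∀ z v, notBeatenProb P r z v ≤ 1 := fun z v => measureReal_le_one
  set ν := (volume.restrict (Set.Ioc 0 w)).prod P
  let M : ℕ → ℝ × 𝓧 → ℝ≥0∞ := fun n z =>
    allAccepted (notBeatenProb P r z) z.1 0 * allAccepted (notBeatenProb P r z) (w + n) z.1
  have hM : ∀ n, Measurable (M n) := fun n =>
    (hb.measurable_allAccepted measurable_fst measurable_const).mul
      (hb.measurable_allAccepted measurable_const measurable_fst)
  have had : Measurable fun z : ℝ × 𝓧 => a z.2 + ENNReal.ofReal z.1 * d z.2 := by fun_prop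
  have hae1 : ∀ᵐ z ∂ν, z.1 ∈ Set.Ioc 0 w :=
    Measure.quasiMeasurePreserving_fst.ae (ae_restrict_mem measurableSet_Ioc)
  have hae3 : ∀ᵐ z ∂ν, a z.2 < ∞ ∧ d z.2 < ∞ :=
    Measure.quasiMeasurePreserving_snd.ae ((ae_lt_top ha ha').and (ae_lt_top hd hd'))
  have hae2 : ∀ᵐ z ∂ν, r z.2 < ∞ :=
    Measure.quasiMeasurePreserving_snd.ae (ae_lt_top hr (by simp [hr1]))
  have hMeq : ∀ z : ℝ × 𝓧, z.1 ∈ Set.Ioc 0 w → ∀ n : ℕ, M n z = ENNReal.ofReal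
      (Real.exp (-∫ v in 0..(w + n), (1 - notBeatenProb P r z v))) := fun z hz n =>
    allAccepted_mul_allAccepted (hb.monotone z) (hb.nonneg z) hz.1.le
      (hz.2.trans (by simp))
  have hbound : ∀ n : ℕ, ∑' n : ℕ, ∫⁻ ω, (a (X n ω) + n * d (X n ω)) *
        (isMaxEvent r X G n ∩ {ω | Real.exp (-G n ω) ≤ w}).indicator 1 ω ∂μ
      ≤ ∫⁻ z, (a z.2 + ENNReal.ofReal z.1 * d z.2) * M n z ∂ν := by
    intro n
    have hmul : Measurable fun z => (a z.2 + ENNReal.ofReal z.1 * d z.2) * M n z := had.mul (hM n)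
    rw [lintegral_prod _ hmul.aemeasurable]
    refine le_trans (ENNReal.tsum_le_tsum fun n => lintegral_mono fun ω => ?_)
      (H.tsum_lintegral_forall_accepted_le hb hb1 ha hd (u := w + n) (by simp))
    refine mul_le_mul' le_rfl (Set.indicator_le_indicator_of_subset ?_ (by simp) ω)
    rintro ω ⟨h1, h2⟩
    exact ⟨fun j _ => Set.indicator_of_mem
      (a := (markedPoint X G n ω, markedPoint X G j ω)) (h1 j) _, h2⟩
  have hlim : Filter.Tendsto
      (fun n : ℕ => ∫⁻ z, (a z.2 + ENNReal.ofReal z.1 * d z.2) * M n z ∂ν) Filter.atTop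
      (nhds (∫⁻ z, (a z.2 + ENNReal.ofReal z.1 * d z.2) * neverBeatenProb r z ∂ν)) := by
    refine tendsto_lintegral_of_dominated_convergence
      (fun z => a z.2 + ENNReal.ofReal w * d z.2) (fun n => had.mul (hM n)) (fun n => ?_) ?_ ?_
    · filter_upwards [hae1] with z hz
      have h1 : M n z ≤ 1 := by
        rw [hMeq z hz, ← ENNReal.ofReal_one]
        refine ENNReal.ofReal_le_ofReal (Real.exp_le_one_iff.2 (neg_nonpos.2 ?_))
        refine intervalIntegral.integral_nonneg ?_ fun v _ => sub_nonneg.2 (hb1 z v)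
        have := hz.1.trans_le hz.2
        positivity
      calc _ ≤ (a z.2 + ENNReal.ofReal z.1 * d z.2) * 1 := by gcongr
        _ ≤ _ := by
          rw [mul_one]
          gcongr
          exact hz.2
    · rw [lintegral_prod _ (by fun_prop)]
      simp only [lintegral_const]
      refine ENNReal.mul_ne_top ?_ (by simp)
      rw [lintegral_add_left ha, lintegral_const_mul _ hd]
      exact ENNReal.add_ne_top.2 ⟨ha', ENNReal.mul_ne_top ENNReal.ofReal_ne_top hd'⟩
    · filter_upwards [hae1, hae2, hae3] with z hz hz2 hz3
      refine ENNReal.Tendsto.const_mul ?_ (Or.inr ?_)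
      · simp only [hMeq z hz]
        exact (tendsto_neverBeatenProb hr hr1 hz.1 hz2.ne).comp
          (Filter.tendsto_atTop_add_const_left _ _ tendsto_natCast_atTop_atTop)
      · exact ENNReal.add_ne_top.2 ⟨hz3.1.ne, ENNReal.mul_ne_top ENNReal.ofReal_ne_top hz3.2.ne⟩
  refine (ge_of_tendsto' hlim hbound).trans ?_
  have hmul : Measurable fun z => (a z.2 + ENNReal.ofReal z.1 * d z.2) * neverBeatenProb r z :=
    had.mul (measurable_neverBeatenProb hr)
  rw [lintegral_prod_symm _ hmul.aemeasurable]
  refine lintegral_mono_ae ?_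
  filter_upwards [ae_lt_top hr (by simp [hr1])] with x hx
  rw [← lintegral_Ioi_neverBeatenProb hx.ne]
  exact lintegral_mono_set Set.Ioc_subset_Ioi_self

lemma measurableSet_isMaxEvent {r : 𝓧 → ℝ≥0∞} (hr : Measurable r) (n : ℕ) :
    MeasurableSet (isMaxEvent r X G n) := by
  have hX := H.measurable_X
  have hG := H.measurable_G
  simp only [isMaxEvent, Set.ofPred_forall]
  exact .iInter fun j => measurableSet_le (by fun_prop) (by fun_prop)

lemma lintegral_tsum_isMaxEvent_le {r : 𝓧 → ℝ≥0∞} (hr : Measurable r) (hr1 : ∫⁻ x, r x ∂P = 1)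
    {a d : 𝓧 → ℝ≥0∞} (ha : Measurable a) (hd : Measurable d) (ha' : ∫⁻ x, a x ∂P ≠ ∞)
    (hd' : ∫⁻ x, d x ∂P ≠ ∞) :
    ∫⁻ ω, ∑' n : ℕ, (a (X n ω) + n * d (X n ω)) * (isMaxEvent r X G n).indicator 1 ω ∂μ
      ≤ ∫⁻ x, (a x * r x + d x * r x ^ 2) ∂P := by
  have hX := H.measurable_X
  have hG := H.measurable_G
  let f : ℕ → Ω → ℝ≥0∞ := fun w ω => ∑' n : ℕ, (a (X n ω) + n * d (X n ω)) *
    (isMaxEvent r X G n ∩ {ω | Real.exp (-G n ω) ≤ w}).indicator 1 ω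
  have hm : ∀ w n : ℕ, Measurable fun ω => (a (X n ω) + n * d (X n ω)) *
      (isMaxEvent r X G n ∩ {ω | Real.exp (-G n ω) ≤ w}).indicator 1 ω := fun w n =>
    (by fun_prop : Measurable fun ω => a (X n ω) + n * d (X n ω)).mul (measurable_one.indicator
      ((H.measurableSet_isMaxEvent hr n).inter (measurableSet_le (by fun_prop) measurable_const)))
  have hmono : Monotone f := fun w w' hw ω => by
    refine ENNReal.tsum_le_tsum fun n => mul_le_mul' le_rfl
      (Set.indicator_le_indicator_of_subset ?_ (by simp) ω)
    exact Set.inter_subset_inter_right _ fun ω (hω : Real.exp (-G n ω) ≤ w) =>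
      hω.trans (Nat.cast_le.2 hw)
  calc _ ≤ ∫⁻ ω, ⨆ w, f w ω ∂μ := by
        refine lintegral_mono fun ω => ?_
        rw [ENNReal.tsum_eq_iSup_sum]
        refine iSup_le fun s => ?_
        -- The sum bounds each of its arrival times, so this cutoff removes no term of the finite
        -- sum.
        obtain ⟨w, hw⟩ := exists_nat_ge (∑ n ∈ s, Real.exp (-G n ω))
        refine le_trans (Finset.sum_le_sum fun n hn => ?_)
          ((ENNReal.sum_le_tsum s).trans (le_iSup (fun w => f w ω) w))
        refine mul_le_mul' le_rfl (le_of_eq ?_)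
        have hn' : ω ∈ {ω | Real.exp (-G n ω) ≤ w} :=
          (Finset.single_le_sum (f := fun n => Real.exp (-G n ω))
            (fun n _ => (Real.exp_pos _).le) hn).trans hw
        by_cases h : ω ∈ isMaxEvent r X G n
        · rw [Set.indicator_of_mem h, Set.indicator_of_mem (Set.mem_inter h hn')]
        · rw [Set.indicator_of_notMem h, Set.indicator_of_notMem fun h' => h h'.1]
    _ = ⨆ w, ∫⁻ ω, f w ω ∂μ := lintegral_iSup (fun w => Measurable.tsum (hm w)) hmono
    _ ≤ _ := by
      refine iSup_le fun w => ?_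
      simp only [f]
      rw [lintegral_tsum fun n => (hm w n).aemeasurable]
      exact H.tsum_lintegral_isMaxEvent_le hr hr1 ha hd ha' hd'

/-- Almost surely the maximal score is attained. -/
lemma ae_exists_isMax {r : 𝓧 → ℝ≥0∞} (hr : Measurable r) (hr1 : ∫⁻ x, r x ∂P ≠ ∞) :
    ∀ᵐ ω ∂μ, ∃ i, ∀ j, aStarScore r (fun i => X i ω) (fun i => G i ω) j
      ≤ aStarScore r (fun i => X i ω) (fun i => G i ω) i := by
  have hP := H.isProbabilityMeasure
  -- Points whose exponentiated score exceeds `1 / (m + 1)` have expected number `(m + 1) * ∫ r dP`,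
  -- by the intensity formula and the layer cake; hence almost surely there are finitely many.
  have h : ∀ m : ℕ, ∀ᵐ ω ∂μ, ∑' n, {z : ℝ × 𝓧 | ((m : ℝ≥0∞) + 1)⁻¹ * ENNReal.ofReal z.1
      < r z.2}.indicator (fun _ => (1 : ℝ≥0∞)) (markedPoint X G n ω) < ∞ := by
    intro m
    have hms : MeasurableSet {z : ℝ × 𝓧 | ((m : ℝ≥0∞) + 1)⁻¹ * ENNReal.ofReal z.1 < r z.2} :=
      measurableSet_lt (by fun_prop) (by fun_prop)
    have hm : Measurable ({z : ℝ × 𝓧 | ((m : ℝ≥0∞) + 1)⁻¹ * ENNReal.ofReal z.1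
      < r z.2}.indicator (fun _ => (1 : ℝ≥0∞))) := measurable_const.indicator hms
    have hmn : ∀ n, Measurable fun ω => {z : ℝ × 𝓧 | ((m : ℝ≥0∞) + 1)⁻¹ * ENNReal.ofReal z.1
        < r z.2}.indicator (fun _ => (1 : ℝ≥0∞)) (markedPoint X G n ω) :=
      fun n => hm.comp (H.measurable_markedPoint n)
    refine ae_lt_top (Measurable.tsum hmn) ?_
    rw [lintegral_tsum fun n => (hmn n).aemeasurable]
    have hc0 : ((m : ℝ≥0∞) + 1)⁻¹ ≠ 0 := by simp
    have hc : ((m : ℝ≥0∞) + 1)⁻¹ ≠ ∞ := by simp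
    refine ne_of_eq_of_ne (H.tsum_lintegral_markedPoint hm) (ne_of_eq_of_ne ?_
      (ENNReal.div_ne_top hr1 hc0))
    rw [← lintegral_Ioi_measure_mul_lt hr hc0 hc]
    refine lintegral_congr fun t => ?_
    rw [← lintegral_indicator_one (measurableSet_lt (by fun_prop) hr)]
    rfl
  filter_upwards [ae_all_iff.2 h] with ω hω
  simp only [aStarScore_eq_log, ENNReal.log_le_log_iff]
  refine exists_forall_le_of_finite_lt fun m => ?_
  refine (ENNReal.finite_const_le_of_tsum_ne_top (hω m).ne one_ne_zero).subset fun n hn => ?_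
  refine (le_of_eq ?_ : (1 : ℝ≥0∞) ≤ _)
  symm
  refine Set.indicator_of_mem (f := fun _ => (1 : ℝ≥0∞)) ?_
  have hn : ((m : ℝ≥0∞) + 1)⁻¹ < r (X n ω) * ENNReal.ofReal (Real.exp (G n ω)) := hn
  show ((m : ℝ≥0∞) + 1)⁻¹ * ENNReal.ofReal (Real.exp (-G n ω)) < r (X n ω)
  have hpos : ENNReal.ofReal (Real.exp (-G n ω)) ≠ 0 := by simp [Real.exp_pos]
  have h1 := ENNReal.mul_lt_mul_left hpos ENNReal.ofReal_ne_top hn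
  rwa [mul_assoc, ← ENNReal.ofReal_mul (Real.exp_pos _).le, ← Real.exp_add, add_neg_cancel,
    Real.exp_zero, ENNReal.ofReal_one, mul_one] at h1

end IsSharedRandomness
end Maximiser

/-! ### The expected logarithm of the selected index -/

/-- The tangent to `log` at `1 + ρ`, evaluated at `n + 1`. The bound is affine in `n`, as the
estimate for the maximiser requires. -/
lemma log_succ_add_one_le {ρ : ℝ} (hρ : 0 ≤ ρ) (n : ℕ) :
    Real.log (n + 1) + 1 ≤ Real.log (1 + ρ) + (1 + ρ)⁻¹ + n * (1 + ρ)⁻¹ := by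
  have h1 : (0 : ℝ) < 1 + ρ := by linarith
  have h2 : (0 : ℝ) < n + 1 := by positivity
  have h := Real.log_le_sub_one_of_pos (div_pos h2 h1)
  rw [Real.log_div h2.ne' h1.ne', div_eq_mul_inv] at h
  linarith

/-- Apply `log x ≤ x - 1` at `x = (1 + ρ) / (2 * ρ)`. The error `(1 - ρ) / 2` has mean zero when `ρ`
is a density; it is split across the two sides to avoid subtraction. -/
lemma mul_log_one_add_le_klFun {ρ : ℝ} (hρ : 0 ≤ ρ) :
    ρ * Real.log (1 + ρ) + 1 / 2 ≤ klFun ρ + ρ * Real.log 2 + ρ / 2 := by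
  rcases hρ.eq_or_lt with rfl | h
  · norm_num [klFun_zero]
  · have h1 := Real.log_le_sub_one_of_pos (x := (1 + ρ) / (2 * ρ)) (by positivity)
    rw [Real.log_div (by positivity) (by positivity), Real.log_mul two_ne_zero h.ne'] at h1
    have h2 := mul_le_mul_of_nonneg_left h1 hρ
    have h3 : ρ * ((1 + ρ) / (2 * ρ) - 1) = (1 - ρ) / 2 := by
      field_simp
      ring
    rw [h3] at h2
    rw [klFun_apply]
    linarith

section LogIndex

variable {Ω 𝓧 : Type*} [MeasurableSpace Ω] [MeasurableSpace 𝓧]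
  {μ : Measure Ω} [IsProbabilityMeasure μ] {P : Measure 𝓧} {X : ℕ → Ω → 𝓧} {G : ℕ → Ω → ℝ}

namespace IsSharedRandomness

variable (H : IsSharedRandomness μ P X G)
include H

/-- With `a = log (1 + r) + 1 / (1 + r)` and `d = 1 / (1 + r)`, the integrand `a r + d r²` collapses
to `r log (1 + r) + r`. The last term integrates to `1`, cancelling the constant of the tangent
line. -/
lemma lintegral_log_le_of_isMaxEvent {r : 𝓧 → ℝ≥0∞} (hr : Measurable r)
    (hr1 : ∫⁻ x, r x ∂P = 1) {N : Ω → ℕ}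
    (hN : ∀ᵐ ω ∂μ, ∃ n, N ω ≤ n + 1 ∧ ω ∈ isMaxEvent r X G n) :
    ∫⁻ ω, ENNReal.ofReal (Real.log (N ω)) ∂μ
      ≤ ∫⁻ x, ENNReal.ofReal (klFun (r x).toReal) ∂P + ENNReal.ofReal (Real.log 2) := by
  have hP := H.isProbabilityMeasure
  let a : 𝓧 → ℝ≥0∞ := fun x =>
    ENNReal.ofReal (Real.log (1 + (r x).toReal) + (1 + (r x).toReal)⁻¹)
  let d : 𝓧 → ℝ≥0∞ := fun x => ENNReal.ofReal (1 + (r x).toReal)⁻¹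
  have ha : Measurable a := by fun_prop
  have hd : Measurable d := by fun_prop
  have hfin : ∀ᵐ x ∂P, r x < ∞ := ae_lt_top hr (by simp [hr1])
  have hinv : ∀ x, (1 + (r x).toReal)⁻¹ ≤ 1 := fun x =>
    inv_le_one_of_one_le₀ (by linarith [(r x).toReal_nonneg])
  have hinv0 : ∀ x, 0 ≤ (1 + (r x).toReal)⁻¹ := fun x =>
    inv_nonneg.2 (by linarith [(r x).toReal_nonneg])
  have hlog0 : ∀ x, 0 ≤ Real.log (1 + (r x).toReal) := fun x =>
    Real.log_nonneg (by linarith [(r x).toReal_nonneg])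
  have ha' : ∫⁻ x, a x ∂P ≠ ∞ := by
    refine ne_top_of_le_ne_top (b := ∫⁻ x, (r x + 1) ∂P) ?_ (lintegral_mono_ae ?_)
    · rw [lintegral_add_right _ measurable_const, hr1]
      simp
    · filter_upwards [hfin] with x hx
      calc a x ≤ ENNReal.ofReal ((r x).toReal + 1) := by
            refine ENNReal.ofReal_le_ofReal (add_le_add ?_ (hinv x))
            have := Real.log_le_sub_one_of_pos (x := 1 + (r x).toReal)
              (by linarith [(r x).toReal_nonneg])
            linarith
        _ = r x + 1 := by
            rw [ENNReal.ofReal_add ENNReal.toReal_nonneg zero_le_one, ENNReal.ofReal_toReal hx.ne,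
              ENNReal.ofReal_one]
  have hd' : ∫⁻ x, d x ∂P ≠ ∞ := by
    refine ne_top_of_le_ne_top (b := ∫⁻ _, 1 ∂P) (by simp) (lintegral_mono fun x => ?_)
    exact ENNReal.ofReal_le_one.2 (hinv x)
  have hcore := H.lintegral_tsum_isMaxEvent_le hr hr1 ha hd ha' hd'
  have hXfin : ∀ᵐ ω ∂μ, ∀ n, r (X n ω) < ∞ := by
    refine ae_all_iff.2 fun n => ?_
    rw [← H.law_X n] at hfin
    exact ae_of_ae_map (H.measurable_X n).aemeasurable hfin
  have hleft : ∫⁻ ω, ENNReal.ofReal (Real.log (N ω)) ∂μ + 1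
      ≤ ∫⁻ x, (a x * r x + d x * r x ^ 2) ∂P := by
    refine le_trans ?_ hcore
    rw [← (by simp : ∫⁻ _, (1 : ℝ≥0∞) ∂μ = 1), ← lintegral_add_right _ measurable_const]
    refine lintegral_mono_ae ?_
    filter_upwards [hN, hXfin] with ω ⟨n, hn, hmax⟩ hω
    refine le_trans ?_ (ENNReal.le_tsum n)
    rw [Set.indicator_of_mem hmax, Pi.one_apply, mul_one]
    have hlog : ENNReal.ofReal (Real.log (N ω)) ≤ ENNReal.ofReal (Real.log (n + 1)) := by
      rcases Nat.eq_zero_or_pos (N ω) with h0 | h0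
      · simp [h0]
      · exact ENNReal.ofReal_le_ofReal
          (Real.log_le_log (by exact_mod_cast h0) (by exact_mod_cast hn))
    have h0 : 0 ≤ Real.log ((n : ℝ) + 1) := Real.log_nonneg (by linarith [n.cast_nonneg (α := ℝ)])
    calc _ ≤ ENNReal.ofReal (Real.log (n + 1)) + 1 := by gcongr
      _ = ENNReal.ofReal (Real.log (n + 1) + 1) := by
        rw [ENNReal.ofReal_add h0 zero_le_one, ENNReal.ofReal_one]
      _ ≤ _ := ENNReal.ofReal_le_ofReal
        (log_succ_add_one_le (ENNReal.toReal_nonneg (a := r (X n ω))) n)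
      _ = _ := by
        rw [ENNReal.ofReal_add (add_nonneg (hlog0 _) (hinv0 _))
          (mul_nonneg n.cast_nonneg (hinv0 _)), ENNReal.ofReal_mul n.cast_nonneg,
          ENNReal.ofReal_natCast]
  have hright : ∫⁻ x, (a x * r x + d x * r x ^ 2) ∂P + ENNReal.ofReal (1 / 2)
      ≤ ∫⁻ x, ENNReal.ofReal (klFun (r x).toReal) ∂P + ENNReal.ofReal (Real.log 2)
        + 1 + ENNReal.ofReal (1 / 2) := by
    have hc : ∀ c : ℝ≥0∞, ∫⁻ _, c ∂P = c := fun c => by simp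
    have hr' : ∀ c : ℝ≥0∞, ∫⁻ x, c * r x ∂P = c := fun c => by
      rw [lintegral_const_mul _ hr, hr1, mul_one]
    calc _ = ∫⁻ x, (a x * r x + d x * r x ^ 2 + ENNReal.ofReal (1 / 2)) ∂P := by
          rw [lintegral_add_right _ measurable_const, hc]
      _ ≤ ∫⁻ x, (ENNReal.ofReal (klFun (r x).toReal) + ENNReal.ofReal (Real.log 2) * r x
          + 1 * r x + ENNReal.ofReal (1 / 2) * r x) ∂P := by
          refine lintegral_mono_ae ?_
          filter_upwards [hfin] with x hx
          have hρ := (r x).toReal_nonneg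
          have hrx : r x = ENNReal.ofReal (r x).toReal := (ENNReal.ofReal_toReal hx.ne).symm
          have hkl := klFun_nonneg hρ
          have hl2 := Real.log_nonneg one_le_two
          have hl := hlog0 x
          have hi := hinv0 x
          simp only [a, d]
          generalize (r x).toReal = ρ at *
          rw [hrx, ← ENNReal.ofReal_pow hρ, ← ENNReal.ofReal_mul (by positivity),
            ← ENNReal.ofReal_mul (by positivity), ← ENNReal.ofReal_add (by positivity)
            (by positivity), ← ENNReal.ofReal_add (by positivity) (by positivity), one_mul,
            ← ENNReal.ofReal_mul (by positivity), ← ENNReal.ofReal_mul (by positivity),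
            ← ENNReal.ofReal_add (by positivity) (by positivity),
            ← ENNReal.ofReal_add (by positivity) (by positivity),
            ← ENNReal.ofReal_add (by positivity) (by positivity)]
          refine ENNReal.ofReal_le_ofReal ?_
          have h1 := mul_log_one_add_le_klFun hρ
          have h2 : (1 + ρ)⁻¹ * ρ + (1 + ρ)⁻¹ * ρ ^ 2 = ρ := by
            field_simp
          linarith
      _ = _ := by
          rw [lintegral_add_right _ (by fun_prop), lintegral_add_right _ (by fun_prop),
            lintegral_add_right _ (by fun_prop), hr', hr', hr']
  have h := (add_le_add_left hleft (ENNReal.ofReal (1 / 2))).trans hright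
  exact ENNReal.le_of_add_le_add_right ENNReal.one_ne_top
    (ENNReal.le_of_add_le_add_right ENNReal.ofReal_ne_top h)

lemma ae_forall_eq_of_ae_eq {r r' : 𝓧 → ℝ≥0∞} (h : r =ᵐ[P] r') :
    ∀ᵐ ω ∂μ, ∀ n, r (X n ω) = r' (X n ω) := by
  refine ae_all_iff.2 fun n => ?_
  have h' : ∀ᵐ x ∂P, r x = r' x := h
  rw [← H.law_X n] at h'
  exact ae_of_ae_map (H.measurable_X n).aemeasurable h'

lemma ae_exists_isMax_of_isUnnormalizedDensity {Q : Measure 𝓧} [IsFiniteMeasure Q]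
    {r : 𝓧 → ℝ≥0∞} (hr : Measurable r) (hrQ : IsUnnormalizedDensity r Q P) :
    ∀ᵐ ω ∂μ, ∃ i, ∀ j, aStarScore r (fun i => X i ω) (fun i => G i ω) j
      ≤ aStarScore r (fun i => X i ω) (fun i => G i ω) i := by
  obtain ⟨c, -, hc, hrc⟩ := hrQ
  refine H.ae_exists_isMax hr ?_
  rw [lintegral_congr_ae hrc, lintegral_const_mul _ (Measure.measurable_rnDeriv _ _)]
  exact ENNReal.mul_ne_top hc (Measure.lintegral_rnDeriv_lt_top Q P).ne

lemma lintegral_log_depthLimitedIndex_le {Q : Measure 𝓧} [IsProbabilityMeasure Q] (hQ : Q ≪ P)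
    {r : 𝓧 → ℝ≥0∞} (hr : Measurable r) (hrQ : IsUnnormalizedDensity r Q P) {k : ℕ} (hk : 1 ≤ k) :
    ∫⁻ ω, ENNReal.ofReal (Real.log
        (depthLimitedIndex (aStarScore r (fun i => X i ω) (fun i => G i ω)) k)) ∂μ
      ≤ klDiv Q P + ENNReal.ofReal (Real.log 2) := by
  -- The estimate is applied to the normalised density: a positive finite factor in `r` does not
  -- change which candidate is maximal.
  have hP := H.isProbabilityMeasure
  rw [klDiv_eq_lintegral_klFun_of_ac hQ]
  refine H.lintegral_log_le_of_isMaxEvent (Measure.measurable_rnDeriv Q P) ?_ ?_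
  · rw [Measure.lintegral_rnDeriv hQ, measure_univ]
  · have hmax := H.ae_exists_isMax_of_isUnnormalizedDensity hr hrQ
    obtain ⟨c, hc0, hc, hrc⟩ := hrQ
    filter_upwards [hmax, H.ae_forall_eq_of_ae_eq hrc] with ω ⟨i, hi⟩ hω
    refine ⟨i, depthLimitedIndex_le_of_mem hk ⟨i, rfl, hi⟩, fun j => ?_⟩
    have h := (aStarScore_le_iff _ _ _ _ _).1 (hi j)
    simp only [hω, mul_assoc] at h
    exact (ENNReal.mul_le_mul_iff_right hc0 hc).1 h

end IsSharedRandomness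
end LogIndex

/-! ### Averaging over the conditioning variable -/

section Channel

variable {𝓧 𝓨 : Type*} [MeasurableSpace 𝓧] [MeasurableSpace 𝓨] [StandardBorelSpace 𝓧] [Nonempty 𝓧]

lemma ae_condKernel_absolutelyContinuous {π : Measure (𝓨 × 𝓧)} [IsFiniteMeasure π]
    (h : π ≪ π.fst.prod π.snd) : ∀ᵐ b ∂π.fst, π.condKernel b ≪ π.snd := by
  have h' : π.fst ⊗ₘ π.condKernel ≪ π.fst ⊗ₘ Kernel.const 𝓨 π.snd := by
    rwa [Measure.disintegrate, Measure.compProd_const]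
  simpa using h'.kernel_of_compProd

/-- The density of `π` with respect to the product of its marginals restricts, for almost every `b`,
to that of the conditional law with respect to `π.snd`. Since `klFun` is nonnegative on densities,
Tonelli gives the identity without integrability. -/
lemma lintegral_klDiv_condKernel {π : Measure (𝓨 × 𝓧)} [IsFiniteMeasure π]
    (h : π ≪ π.fst.prod π.snd) :
    ∫⁻ b, klDiv (π.condKernel b) π.snd ∂π.fst = klDiv π (π.fst.prod π.snd) := by
  set f := Kernel.rnDeriv π.condKernel (Kernel.const 𝓨 π.snd) with hf
  have hfm : Measurable (Function.uncurry f) := Kernel.measurable_rnDeriv _ _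
  have hac := ae_condKernel_absolutelyContinuous h
  have hdens : π = (π.fst.prod π.snd).withDensity (Function.uncurry f) := by
    ext s hs
    conv_lhs => rw [← π.disintegrate π.condKernel, Measure.compProd_apply hs]
    rw [withDensity_apply _ hs, ← lintegral_indicator hs,
      lintegral_prod _ (hfm.indicator hs).aemeasurable]
    refine lintegral_congr_ae ?_
    filter_upwards [hac] with b hb
    have h1 : π.condKernel b = π.snd.withDensity (f b) := by
      have := Kernel.withDensity_rnDeriv_eq (κ := π.condKernel) (η := Kernel.const 𝓨 π.snd)
        (a := b) (by simpa using hb)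
      rw [← this, Kernel.withDensity_apply _ hfm, Kernel.const_apply]
    have hsb : MeasurableSet (Prod.mk b ⁻¹' s) := measurable_prodMk_left hs
    rw [h1, withDensity_apply _ hsb, ← lintegral_indicator hsb]
    rfl
  have hrn : π.rnDeriv (π.fst.prod π.snd) =ᵐ[π.fst.prod π.snd] Function.uncurry f := by
    have h := Measure.rnDeriv_withDensity (π.fst.prod π.snd) hfm
    rwa [← hdens] at h
  rw [klDiv_eq_lintegral_klFun_of_ac h, lintegral_congr_ae (hrn.mono fun z hz => by rw [hz]),
    lintegral_prod _ (by fun_prop)]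
  refine lintegral_congr_ae ?_
  filter_upwards [hac] with b hb
  rw [klDiv_eq_lintegral_klFun_of_ac hb]
  have h2 := Kernel.rnDeriv_eq_rnDeriv_measure (κ := π.condKernel) (η := Kernel.const 𝓨 π.snd)
    (a := b)
  rw [Kernel.const_apply] at h2
  exact lintegral_congr_ae (h2.mono fun x hx => by simp only [Function.uncurry, hf, hx])

end Channel

section ChannelSimulation

variable {Ω 𝓧 𝓨 : Type*} [MeasurableSpace Ω] [MeasurableSpace 𝓧] [MeasurableSpace 𝓨]
  {μ : Measure Ω}

lemma lintegral_prodMk_of_indepFun {α β : Type*} [MeasurableSpace α] [MeasurableSpace β]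
    [IsFiniteMeasure μ] {y : Ω → α} {z : Ω → β} (hy : Measurable y) (hz : Measurable z)
    (h : IndepFun y z μ) {f : α × β → ℝ≥0∞} (hf : Measurable f) :
    ∫⁻ ω, f (y ω, z ω) ∂μ = ∫⁻ b, ∫⁻ ω, f (b, z ω) ∂μ ∂(μ.map y) := by
  have hmap := (indepFun_iff_map_prod_eq_prod_map_map hy.aemeasurable hz.aemeasurable).1 h
  rw [← lintegral_map hf (hy.prodMk hz), hmap, lintegral_prod _ hf.aemeasurable]
  refine lintegral_congr fun b => ?_
  exact lintegral_map (hf.comp measurable_prodMk_left) hz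

lemma ae_prodMk_of_indepFun {α β : Type*} [MeasurableSpace α] [MeasurableSpace β]
    [IsFiniteMeasure μ] {y : Ω → α} {z : Ω → β} (hy : Measurable y) (hz : Measurable z)
    (h : IndepFun y z μ) {s : Set (α × β)} (hs : MeasurableSet s)
    (hae : ∀ᵐ b ∂(μ.map y), ∀ᵐ ω ∂μ, (b, z ω) ∈ s) : ∀ᵐ ω ∂μ, (y ω, z ω) ∈ s := by
  have hmap := (indepFun_iff_map_prod_eq_prod_map_map hy.aemeasurable hz.aemeasurable).1 h
  have hp : ∀ᵐ q ∂((μ.map y).prod (μ.map z)), q ∈ s := by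
    refine (Measure.ae_prod_mem_iff_ae_ae_mem hs).2 ?_
    filter_upwards [hae] with b hb
    exact (ae_map_iff hz.aemeasurable (measurable_prodMk_left hs)).2 hb
  rw [← hmap] at hp
  exact ae_of_ae_map (hy.prodMk hz).aemeasurable hp

lemma measurable_aStarScore_uncurry {r : 𝓨 → 𝓧 → ℝ≥0∞} (hr : Measurable (Function.uncurry r))
    (i : ℕ) : Measurable fun q : 𝓨 × ((ℕ → 𝓧) × (ℕ → ℝ)) => aStarScore (r q.1) q.2.1 q.2.2 i := by
  have hr' : Measurable
      (Function.uncurry fun q : 𝓨 × ((ℕ → 𝓧) × (ℕ → ℝ)) => r q.1) :=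
    hr.comp ((measurable_fst.comp measurable_fst).prodMk measurable_snd)
  exact measurable_aStarScore (x := fun i q => q.2.1 i) (g := fun i q => q.2.2 i) hr'
    (fun i => by fun_prop) (fun i => by fun_prop) i

lemma mutualInfoBits_nonneg (π : Measure (𝓨 × 𝓧)) : 0 ≤ mutualInfoBits π :=
  div_nonneg ENNReal.toReal_nonneg (Real.log_nonneg one_le_two)

lemma expLogIndex_mono {N N' : Ω → ℕ} (h1 : ∀ ω, 1 ≤ N' ω) (h : ∀ᵐ ω ∂μ, N' ω ≤ N ω) :
    expLogIndex μ N' ≤ expLogIndex μ N := by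
  refine lintegral_mono_ae ?_
  filter_upwards [h] with ω hω
  refine ENNReal.ofReal_le_ofReal (Real.logb_le_logb_of_le one_lt_two ?_ ?_)
  · exact_mod_cast h1 ω
  · exact_mod_cast hω

variable [StandardBorelSpace 𝓧] [Nonempty 𝓧] [IsProbabilityMeasure μ]
  {P : Measure 𝓧} {X : ℕ → Ω → 𝓧} {G : ℕ → Ω → ℝ}

namespace IsSharedRandomness
variable (H : IsSharedRandomness μ P X G)
include H

omit [StandardBorelSpace 𝓧] [Nonempty 𝓧] in
lemma measurable_randomness :
    Measurable fun ω => ((fun i => X i ω : ℕ → 𝓧), (fun i => G i ω : ℕ → ℝ)) :=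
  (measurable_pi_lambda _ H.measurable_X).prodMk (measurable_pi_lambda _ H.measurable_G)

variable {π : Measure (𝓨 × 𝓧)} [IsProbabilityMeasure π] {y : Ω → 𝓨} {r : 𝓨 → 𝓧 → ℝ≥0∞}

lemma ae_exists_isMax_of_indepFun (hy : Measurable y) (hyπ : μ.map y = π.fst)
    (hind : IndepFun y (fun ω => ((fun i => X i ω : ℕ → 𝓧), (fun i => G i ω : ℕ → ℝ))) μ)
    (hr : Measurable (Function.uncurry r))
    (hrπ : ∀ᵐ b ∂π.fst, IsUnnormalizedDensity (r b) (π.condKernel b) P) :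
    ∀ᵐ ω ∂μ, ∃ i, ∀ j, aStarScore (r (y ω)) (fun i => X i ω) (fun i => G i ω) j
      ≤ aStarScore (r (y ω)) (fun i => X i ω) (fun i => G i ω) i := by
  refine ae_prodMk_of_indepFun hy H.measurable_randomness hind
    (measurableSet_exists_isMax (measurable_aStarScore_uncurry hr)) ?_
  rw [hyπ]
  filter_upwards [hrπ] with b hb
  exact H.ae_exists_isMax_of_isUnnormalizedDensity (hr.comp measurable_prodMk_left) hb

lemma lintegral_log_depthLimitedIndex_le_klDiv (hπP : π.snd = P)
    (hkl : klDiv π (π.fst.prod π.snd) ≠ ∞) (hy : Measurable y) (hyπ : μ.map y = π.fst)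
    (hind : IndepFun y (fun ω => ((fun i => X i ω : ℕ → 𝓧), (fun i => G i ω : ℕ → ℝ))) μ)
    (hr : Measurable (Function.uncurry r))
    (hrπ : ∀ᵐ b ∂π.fst, IsUnnormalizedDensity (r b) (π.condKernel b) P) {k : ℕ} (hk : 1 ≤ k) :
    ∫⁻ ω, ENNReal.ofReal (Real.log
        (depthLimitedIndex (aStarScore (r (y ω)) (fun i => X i ω) (fun i => G i ω)) k)) ∂μ
      ≤ klDiv π (π.fst.prod π.snd) + ENNReal.ofReal (Real.log 2) := by
  have hac : π ≪ π.fst.prod π.snd := (klDiv_ne_top_iff.1 hkl).1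
  have hm : Measurable fun q : 𝓨 × ((ℕ → 𝓧) × (ℕ → ℝ)) => ENNReal.ofReal (Real.log
      (depthLimitedIndex (aStarScore (r q.1) q.2.1 q.2.2) k)) := by
    have := measurable_depthLimitedIndex (measurable_aStarScore_uncurry hr) k
    fun_prop
  have hfub := lintegral_prodMk_of_indepFun hy H.measurable_randomness hind hm
  rw [hyπ] at hfub
  refine hfub.trans_le ?_
  calc _ ≤ ∫⁻ b, (klDiv (π.condKernel b) π.snd + ENNReal.ofReal (Real.log 2)) ∂π.fst := by
        refine lintegral_mono_ae ?_
        filter_upwards [hrπ, ae_condKernel_absolutelyContinuous hac] with b hb hb'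
        rw [hπP] at hb' ⊢
        exact H.lintegral_log_depthLimitedIndex_le hb' (hr.comp measurable_prodMk_left) hb hk
    _ = _ := by
        rw [lintegral_add_right _ measurable_const, lintegral_klDiv_condKernel hac,
          lintegral_const, measure_univ, mul_one]

lemma expLogIndex_depthLimitedIndex_le (hπP : π.snd = P)
    (hkl : klDiv π (π.fst.prod π.snd) ≠ ∞) (hy : Measurable y) (hyπ : μ.map y = π.fst)
    (hind : IndepFun y (fun ω => ((fun i => X i ω : ℕ → 𝓧), (fun i => G i ω : ℕ → ℝ))) μ)
    (hr : Measurable (Function.uncurry r))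
    (hrπ : ∀ᵐ b ∂π.fst, IsUnnormalizedDensity (r b) (π.condKernel b) P) {k : ℕ} (hk : 1 ≤ k) :
    expLogIndex μ (fun ω => depthLimitedIndex
        (aStarScore (r (y ω)) (fun i => X i ω) (fun i => G i ω)) k)
      ≤ ENNReal.ofReal (mutualInfoBits π + 1) := by
  have hl2 : 0 < Real.log 2 := Real.log_pos one_lt_two
  have h := H.lintegral_log_depthLimitedIndex_le_klDiv hπP hkl hy hyπ hind hr hrπ hk
  have hI : ENNReal.ofReal (mutualInfoBits π + 1)
      = (klDiv π (π.fst.prod π.snd) + ENNReal.ofReal (Real.log 2))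
        * ENNReal.ofReal (Real.log 2)⁻¹ := by
    rw [← ENNReal.ofReal_toReal hkl, ← ENNReal.ofReal_add ENNReal.toReal_nonneg hl2.le,
      ← ENNReal.ofReal_mul (by positivity), mutualInfoBits]
    congr 1
    field_simp
  rw [hI, expLogIndex]
  refine le_trans (le_of_eq ?_) (mul_le_mul_left h _)
  rw [← lintegral_mul_const' _ _ ENNReal.ofReal_ne_top]
  refine lintegral_congr fun ω => ?_
  rw [← ENNReal.ofReal_mul (Real.log_natCast_nonneg _)]
  rfl

end IsSharedRandomness

end ChannelSimulation

/-! ### Zeta codes and entropy bounds -/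

section PrefixCode

/-- The list of the `l` lowest binary digits of `a`, most significant digit first. -/
def binaryWord (l a : ℕ) : List Bool := (List.range l).map fun i => a.testBit (l - 1 - i)

@[simp] lemma length_binaryWord (l a : ℕ) : (binaryWord l a).length = l := by simp [binaryWord]

/-- The most significant digits come first, so passing to a prefix drops the `l' - l` lowest digits.
-/
lemma eq_div_of_binaryWord_prefix {l l' a a' : ℕ} (ha : a < 2 ^ l) (ha' : a' < 2 ^ l')
    (h : binaryWord l a <+: binaryWord l' a') : a = a' / 2 ^ (l' - l) := by
  have hl : l ≤ l' := by simpa using h.length_le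
  have hb : a' / 2 ^ (l' - l) < 2 ^ l := by
    rw [Nat.div_lt_iff_lt_mul (by positivity), ← pow_add]
    rwa [Nat.add_sub_cancel' hl]
  refine Nat.eq_of_testBit_eq fun i => ?_
  rcases lt_or_ge i l with hi | hi
  · have hlt : l - 1 - i < (binaryWord l a).length := by simp; omega
    have h1 := h.getElem hlt
    simp only [binaryWord, List.getElem_map, List.getElem_range] at h1
    rw [show l - 1 - (l - 1 - i) = i by omega,
      show l' - 1 - (l - 1 - i) = i + (l' - l) by omega] at h1
    rw [h1, Nat.testBit_div_two_pow]
  · have hpow : 2 ^ l ≤ 2 ^ i := Nat.pow_le_pow_right two_pos hi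
    rw [Nat.testBit_lt_two_pow (ha.trans_le hpow), Nat.testBit_lt_two_pow (hb.trans_le hpow)]

/-- Kraft's theorem for a nondecreasing sequence of codeword lengths. -/
theorem exists_prefixCode_of_sum_le_one {l : ℕ → ℕ} (hl : Monotone l)
    (hsum : ∀ n, ∑ m ∈ Finset.range n, ((2 : ℝ) ^ l m)⁻¹ ≤ 1) :
    ∃ c : ℕ → List Bool, (∀ m n, c m <+: c n → m = n) ∧ ∀ n, (c n).length = l n := by
  -- The codeword is the binary expansion of the Kraft sum over earlier indices, scaled by `2 ^ l
  -- n`; monotone lengths make it an integer. Below, `hlt` says that it fits into `l n` digits and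
  -- `hstep` that the dyadic intervals of distinct words are disjoint.
  let a : ℕ → ℕ := fun n => ∑ m ∈ Finset.range n, 2 ^ (l n - l m)
  have hlt : ∀ n, a n < 2 ^ l n := by
    intro n
    have h1 : (a n : ℝ) = 2 ^ l n * ∑ m ∈ Finset.range n, ((2 : ℝ) ^ l m)⁻¹ := by
      simp only [a]
      push_cast
      rw [Finset.mul_sum]
      refine Finset.sum_congr rfl fun m hm => ?_
      exact pow_sub₀ _ two_ne_zero (hl (Finset.mem_range.1 hm).le)
    have h2 := hsum (n + 1)
    rw [Finset.sum_range_succ] at h2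
    have h3 : (0 : ℝ) < ((2 : ℝ) ^ l n)⁻¹ := by positivity
    have h4 : (a n : ℝ) < 2 ^ l n := by
      rw [h1]
      exact mul_lt_of_lt_one_right (by positivity) (by linarith)
    exact_mod_cast h4
  have hstep : ∀ m n, m < n → (a m + 1) * 2 ^ (l n - l m) ≤ a n := by
    intro m n hmn
    calc (a m + 1) * 2 ^ (l n - l m) = ∑ j ∈ Finset.range (m + 1), 2 ^ (l n - l j) := by
          rw [Finset.sum_range_succ, add_mul, one_mul, Finset.sum_mul]
          congr 1
          refine Finset.sum_congr rfl fun j hj => ?_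
          have h1 := hl (Finset.mem_range.1 hj).le
          have h2 := hl hmn.le
          rw [← pow_add]
          congr 1
          omega
      _ ≤ a n := Finset.sum_le_sum_of_subset (Finset.range_subset_range.2 hmn)
  refine ⟨fun n => binaryWord (l n) (a n), fun m n h => ?_, fun n => length_binaryWord _ _⟩
  have hmn := eq_div_of_binaryWord_prefix (hlt m) (hlt n) h
  have hlen : l m ≤ l n := by simpa using h.length_le
  rcases lt_trichotomy m n with hlt' | heq | hgt
  · have := (Nat.le_div_iff_mul_le (by positivity)).2 (hstep m n hlt')
    omega
  · exact heq
  · have hle : l m = l n := le_antisymm hlen (hl hgt.le)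
    have := hstep n m hgt
    rw [hle, Nat.sub_self, pow_zero, Nat.div_one] at hmn
    rw [hle, Nat.sub_self, pow_zero] at this
    omega

end PrefixCode

/-! ### The zeta distribution, its codelengths and its prefix code -/

section ZetaMass

variable {s : ℝ}

lemma summable_add_one_rpow_neg (hs : 1 < s) : Summable fun m : ℕ => ((m : ℝ) + 1) ^ (-s) := by
  have h := (summable_nat_add_iff (f := fun m : ℕ => (m : ℝ) ^ (-s)) 1).2
    (Real.summable_nat_rpow.2 (by linarith))
  simpa using h

lemma one_le_tsum_add_one_rpow_neg (hs : 1 < s) : 1 ≤ ∑' m : ℕ, ((m : ℝ) + 1) ^ (-s) := by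
  have h := (summable_add_one_rpow_neg hs).le_tsum 0 fun m _ => by positivity
  simpa using h

/-- In the formula for the zeta sum minus `1 / (s - 1)`, the correction subtracted from `1` is a sum
of nonnegative terms. -/
lemma tsum_add_one_rpow_neg_le (hs : 1 < s) :
    ∑' m : ℕ, ((m : ℝ) + 1) ^ (-s) ≤ 1 + 1 / (s - 1) := by
  have h := ZetaAsymptotics.zeta_limit_aux1 hs
  have h0 : 0 ≤ ZetaAsymptotics.termTSum s := tsum_nonneg fun n => ZetaAsymptotics.term_nonneg _ _
  have heq : ∑' m : ℕ, ((m : ℝ) + 1) ^ (-s) = ∑' n : ℕ, 1 / ((n : ℝ) + 1) ^ s :=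
    tsum_congr fun m => by rw [Real.rpow_neg (by positivity), one_div]
  have h1 : 0 ≤ s * ZetaAsymptotics.termTSum s := by positivity
  rw [heq]
  linarith

lemma hasSum_zetaMass (hs : 1 < s) : HasSum (zetaMass s) 1 := by
  have hZ : 0 < ∑' m : ℕ, ((m : ℝ) + 1) ^ (-s) :=
    one_pos.trans_le (one_le_tsum_add_one_rpow_neg hs)
  -- The convention that `0` to a nonzero power is `0` gives index `0` no mass, so summing over all
  -- of `ℕ` is harmless.
  have h0 : zetaMass s 0 = 0 := by
    simp [zetaMass, Real.zero_rpow (show -s ≠ 0 by linarith)]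
  have h := (summable_add_one_rpow_neg hs).hasSum.div_const (∑' m : ℕ, ((m : ℝ) + 1) ^ (-s))
  rw [div_self hZ.ne'] at h
  rw [← hasSum_nat_add_iff' 1, Finset.sum_range_one, h0, sub_zero]
  simpa [zetaMass] using h

lemma zetaMass_nonneg (s : ℝ) (n : ℕ) : 0 ≤ zetaMass s n :=
  div_nonneg (by positivity) (tsum_nonneg fun m => by positivity)

lemma zetaMass_pos (hs : 1 < s) {n : ℕ} (hn : 1 ≤ n) : 0 < zetaMass s n :=
  div_pos (Real.rpow_pos_of_pos (by exact_mod_cast hn) _)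
    (one_pos.trans_le (one_le_tsum_add_one_rpow_neg hs))

lemma tsum_ofReal_zetaMass (hs : 1 < s) : ∑' n, ENNReal.ofReal (zetaMass s n) = 1 := by
  rw [← ENNReal.ofReal_tsum_of_nonneg (zetaMass_nonneg s) (hasSum_zetaMass hs).summable,
    (hasSum_zetaMass hs).tsum_eq, ENNReal.ofReal_one]

lemma neg_logb_zetaMass (hs : 1 < s) {n : ℕ} (hn : 1 ≤ n) :
    -Real.logb 2 (zetaMass s n)
      = s * Real.logb 2 n + Real.logb 2 (∑' m : ℕ, ((m : ℝ) + 1) ^ (-s)) := by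
  have hn' : (0 : ℝ) < n := by exact_mod_cast hn
  have hZ : 0 < ∑' m : ℕ, ((m : ℝ) + 1) ^ (-s) :=
    one_pos.trans_le (one_le_tsum_add_one_rpow_neg hs)
  rw [zetaMass, Real.logb_div (Real.rpow_pos_of_pos hn' _).ne' hZ.ne',
    Real.logb_rpow_eq_mul_logb_of_pos hn']
  ring

lemma neg_logb_zetaMass_nonneg (hs : 1 < s) {n : ℕ} (hn : 1 ≤ n) :
    0 ≤ -Real.logb 2 (zetaMass s n) := by
  rw [neg_logb_zetaMass hs hn]
  have h1 := Real.logb_nonneg one_lt_two (one_le_tsum_add_one_rpow_neg hs)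
  have h2 : 0 ≤ Real.logb 2 n := Real.logb_nonneg one_lt_two (by exact_mod_cast hn)
  positivity

lemma neg_logb_zetaMass_mono (hs : 1 < s) {m n : ℕ} (hm : 1 ≤ m) (hmn : m ≤ n) :
    -Real.logb 2 (zetaMass s m) ≤ -Real.logb 2 (zetaMass s n) := by
  rw [neg_logb_zetaMass hs hm, neg_logb_zetaMass hs (hm.trans hmn)]
  have : Real.logb 2 m ≤ Real.logb 2 n :=
    Real.logb_le_logb_of_le one_lt_two (by exact_mod_cast hm) (by exact_mod_cast hmn)
  gcongr

theorem exists_isZetaCode (hs : 1 < s) : ∃ c, IsZetaCode s c := by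
  obtain ⟨c, hc, hlen⟩ := exists_prefixCode_of_sum_le_one
    (l := fun n => ⌈-Real.logb 2 (zetaMass s (n + 1))⌉₊)
    (fun m n hmn => Nat.ceil_mono (neg_logb_zetaMass_mono hs (by omega) (by omega)))
    (fun n => by
      have hle : ∀ m, ((2 : ℝ) ^ ⌈-Real.logb 2 (zetaMass s (m + 1))⌉₊)⁻¹ ≤ zetaMass s (m + 1) := by
        intro m
        have hpos := zetaMass_pos hs (Nat.le_add_left 1 m)
        rw [inv_le_comm₀ (by positivity) hpos, ← Real.rpow_natCast]
        calc (zetaMass s (m + 1))⁻¹ = (2 : ℝ) ^ (-Real.logb 2 (zetaMass s (m + 1))) := by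
              rw [Real.rpow_neg two_pos.le, Real.rpow_logb two_pos (by norm_num) hpos]
          _ ≤ _ := Real.rpow_le_rpow_of_exponent_le one_le_two (Nat.le_ceil _)
      refine (Finset.sum_le_sum fun m _ => hle m).trans ?_
      have h := (hasSum_zetaMass hs).summable.sum_le_tsum (Finset.range (n + 1))
        fun i _ => zetaMass_nonneg s i
      rw [(hasSum_zetaMass hs).tsum_eq, Finset.sum_range_succ'] at h
      linarith [zetaMass_nonneg s 0])
  refine ⟨fun n => c (n - 1), fun m n hm hn h => ?_, fun n hn => ?_⟩
  · have := hc _ _ h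
    omega
  · rw [hlen, Nat.sub_add_cancel hn]

variable {Ω : Type*} [MeasurableSpace Ω] {μ : Measure Ω} [IsProbabilityMeasure μ]

lemma zetaCodelength_le (hs : 1 < s) {N : Ω → ℕ} (hN : ∀ ω, 1 ≤ N ω) {x : ℝ} (hx : 0 ≤ x)
    (h : expLogIndex μ N ≤ ENNReal.ofReal x) :
    zetaCodelength μ s N ≤ ENNReal.ofReal (s * x + Real.logb 2 (1 + 1 / (s - 1))) := by
  have hZ := one_le_tsum_add_one_rpow_neg hs
  have hL := Real.logb_nonneg one_lt_two hZ
  have hle : Real.logb 2 (∑' m : ℕ, ((m : ℝ) + 1) ^ (-s)) ≤ Real.logb 2 (1 + 1 / (s - 1)) :=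
    Real.logb_le_logb_of_le one_lt_two (one_pos.trans_le hZ) (tsum_add_one_rpow_neg_le hs)
  calc zetaCodelength μ s N
      = ∫⁻ ω, (ENNReal.ofReal s * ENNReal.ofReal (Real.logb 2 (N ω))
          + ENNReal.ofReal (Real.logb 2 (∑' m : ℕ, ((m : ℝ) + 1) ^ (-s)))) ∂μ := by
        refine lintegral_congr fun ω => ?_
        have h2 : 0 ≤ Real.logb 2 (N ω) := Real.logb_nonneg one_lt_two (by exact_mod_cast hN ω)
        rw [neg_logb_zetaMass hs (hN ω), ENNReal.ofReal_add (by positivity) hL,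
          ENNReal.ofReal_mul (by positivity)]
    _ = ENNReal.ofReal s * expLogIndex μ N
          + ENNReal.ofReal (Real.logb 2 (∑' m : ℕ, ((m : ℝ) + 1) ^ (-s))) := by
        rw [lintegral_add_right _ measurable_const, lintegral_const_mul' _ _ ENNReal.ofReal_ne_top,
          lintegral_const, measure_univ, mul_one, expLogIndex]
    _ ≤ ENNReal.ofReal s * ENNReal.ofReal x + ENNReal.ofReal (Real.logb 2 (1 + 1 / (s - 1))) := by
        gcongr
    _ = _ := by
        rw [← ENNReal.ofReal_mul (by positivity), ENNReal.ofReal_add (by positivity)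
          (hL.trans hle)]

lemma lintegral_length_le {c : ℕ → List Bool} (hs : 1 < s) (hc : IsZetaCode s c) {N : Ω → ℕ}
    (hN : ∀ ω, 1 ≤ N ω) :
    ∫⁻ ω, ((c (N ω)).length : ℝ≥0∞) ∂μ ≤ zetaCodelength μ s N + 1 := by
  calc _ ≤ ∫⁻ ω, (ENNReal.ofReal (-Real.logb 2 (zetaMass s (N ω))) + 1) ∂μ := by
        refine lintegral_mono fun ω => ?_
        have h0 := neg_logb_zetaMass_nonneg hs (hN ω)
        rw [hc.length_eq _ (hN ω), ← ENNReal.ofReal_natCast, ← ENNReal.ofReal_one,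
          ← ENNReal.ofReal_add h0 one_pos.le]
        exact ENNReal.ofReal_le_ofReal (Nat.ceil_lt_add_one h0).le
    _ = _ := by
        rw [lintegral_add_right _ measurable_const, lintegral_const, measure_univ, mul_one,
          zetaCodelength]

end ZetaMass

/-! ### Entropy against cross entropy -/

section Gibbs

/-- Gibbs' inequality: the cross entropy with respect to a sub-probability mass function is at least
the entropy. -/
theorem entropyBits_le_lintegral (ν : Measure ℕ) [IsProbabilityMeasure ν] {η : ℕ → ℝ}
    (hη : ∀ n, 0 ≤ η n) (hη1 : ∀ n, η n ≤ 1) (hpos : ∀ n, ν {n} ≠ 0 → 0 < η n)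
    (hsum : ∑' n, ENNReal.ofReal (η n) ≤ 1) :
    entropyBits ν ≤ ∫⁻ n, ENNReal.ofReal (-Real.logb 2 (η n)) ∂ν := by
  have hl2 : 0 < Real.log 2 := Real.log_pos one_lt_two
  -- This is `log x ≤ x - 1` at `x = η n / ν {n}`, with the masses kept on opposite sides so that
  -- all terms are nonnegative. After summation they contribute `1` on the left and at most `1` on
  -- the right.
  have hpt : ∀ n, ENNReal.ofReal (Real.negMulLog (ν.real {n}) / Real.log 2)
      + ν {n} * ENNReal.ofReal (Real.log 2)⁻¹
      ≤ ENNReal.ofReal (-Real.logb 2 (η n)) * ν {n}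
        + ENNReal.ofReal (η n) * ENNReal.ofReal (Real.log 2)⁻¹ := by
    intro n
    rcases eq_or_ne (ν {n}) 0 with h0 | h0
    · simp [h0, measureReal_def]
    have hη0 := hpos n h0
    have hp0 : 0 < ν.real {n} := ENNReal.toReal_pos h0 (measure_ne_top _ _)
    have hp1 : ν.real {n} ≤ 1 := measureReal_le_one
    have hlog : 0 ≤ -Real.logb 2 (η n) :=
      neg_nonneg.2 (Real.logb_nonpos one_lt_two (hη n) (hη1 n))
    have hneg := Real.negMulLog_nonneg hp0.le hp1
    rw [← ENNReal.ofReal_toReal (measure_ne_top ν {n}), ← measureReal_def,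
      ← ENNReal.ofReal_mul hp0.le, ← ENNReal.ofReal_mul hlog, ← ENNReal.ofReal_mul (hη n),
      ← ENNReal.ofReal_add (by positivity) (by positivity),
      ← ENNReal.ofReal_add (by positivity) (by positivity)]
    refine ENNReal.ofReal_le_ofReal ?_
    have h1 := Real.log_le_sub_one_of_pos (div_pos hη0 hp0)
    rw [Real.log_div hη0.ne' hp0.ne'] at h1
    have h2 := mul_le_mul_of_nonneg_left h1 hp0.le
    have h3 : ν.real {n} * (η n / ν.real {n} - 1) = η n - ν.real {n} := by field_simp
    rw [h3] at h2
    rw [Real.negMulLog, Real.logb, ← sub_nonneg]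
    have : -(Real.log (η n) / Real.log 2) * ν.real {n} + η n * (Real.log 2)⁻¹
        - (-ν.real {n} * Real.log (ν.real {n}) / Real.log 2 + ν.real {n} * (Real.log 2)⁻¹)
        = (η n - ν.real {n} - ν.real {n} * (Real.log (η n) - Real.log (ν.real {n})))
          / Real.log 2 := by
      field_simp
      ring
    rw [this]
    exact div_nonneg (by linarith) hl2.le
  have htot : ∑' n, ν {n} = 1 := by
    have h := lintegral_countable' (μ := ν) fun _ => (1 : ℝ≥0∞)
    simpa using h.symm
  have h := ENNReal.tsum_le_tsum hpt
  rw [ENNReal.tsum_add, ENNReal.tsum_add, ENNReal.tsum_mul_right, ENNReal.tsum_mul_right, htot,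
    one_mul, ← lintegral_countable'] at h
  refine ENNReal.le_of_add_le_add_right (a := ENNReal.ofReal (Real.log 2)⁻¹)
    ENNReal.ofReal_ne_top (h.trans ?_)
  gcongr
  exact mul_le_of_le_one_left' hsum

variable {Ω : Type*} [MeasurableSpace Ω] {μ : Measure Ω} [IsProbabilityMeasure μ] {s : ℝ}

lemma zetaMass_le_one (hs : 1 < s) (n : ℕ) : zetaMass s n ≤ 1 :=
  le_hasSum (hasSum_zetaMass hs) n fun m _ => zetaMass_nonneg s m

omit [IsProbabilityMeasure μ] in
lemma exists_eq_of_map_singleton_ne_zero {N : Ω → ℕ} (hN : Measurable N) {n : ℕ} (h : μ.map N {n} ≠ 0) :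
    ∃ ω, N ω = n := by
  by_contra! hcon
  refine h ?_
  rw [Measure.map_apply hN (measurableSet_singleton n)]
  convert measure_empty (μ := μ)
  ext ω
  simpa using hcon ω

theorem entropyBits_map_le_zetaCodelength (hs : 1 < s) {N : Ω → ℕ} (hNm : Measurable N)
    (hN : ∀ ω, 1 ≤ N ω) : entropyBits (μ.map N) ≤ zetaCodelength μ s N := by
  have := Measure.isProbabilityMeasure_map (μ := μ) hNm.aemeasurable
  refine (entropyBits_le_lintegral (μ.map N) (zetaMass_nonneg s) (zetaMass_le_one hs) ?_
    (tsum_ofReal_zetaMass hs).le).trans_eq ?_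
  · intro n hn
    obtain ⟨ω, rfl⟩ := exists_eq_of_map_singleton_ne_zero hNm hn
    exact zetaMass_pos hs (hN ω)
  · rw [lintegral_map (measurable_of_countable _) hNm, zetaCodelength]

/-- The entropy of an index that may take the extra value `0`. -/
theorem entropyBits_map_le_zetaCodelength_max (hs : 1 < s) {N : Ω → ℕ} (hNm : Measurable N) :
    entropyBits (μ.map N) ≤ zetaCodelength μ s (fun ω => max 1 (N ω)) + 1 := by
  have := Measure.isProbabilityMeasure_map (μ := μ) hNm.aemeasurable
  -- The mass of `1` is shared equally between `0` and `1`, which costs at most one extra bit.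
  let η : ℕ → ℝ := fun n => if n ≤ 1 then zetaMass s 1 / 2 else zetaMass s n
  have hη0 : ∀ n, 0 < η n := by
    intro n
    simp only [η]
    split_ifs with h
    · exact half_pos (zetaMass_pos hs le_rfl)
    · exact zetaMass_pos hs (by omega)
  have hη1 : ∀ n, η n ≤ 1 := by
    intro n
    simp only [η]
    split_ifs with h
    · linarith [zetaMass_le_one hs 1]
    · exact zetaMass_le_one hs n
  have hsum : ∑' n, ENNReal.ofReal (η n) ≤ 1 := by
    rw [← tsum_ofReal_zetaMass hs, tsum_eq_zero_add' ENNReal.summable,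
      tsum_eq_zero_add' ENNReal.summable, tsum_eq_zero_add' (f := fun n =>
      ENNReal.ofReal (zetaMass s n)) ENNReal.summable, tsum_eq_zero_add' (f := fun n =>
      ENNReal.ofReal (zetaMass s (n + 1))) ENNReal.summable, ← add_assoc, ← add_assoc]
    have h01 : ENNReal.ofReal (η 0) + ENNReal.ofReal (η (0 + 1))
        = ENNReal.ofReal (zetaMass s (0 + 1)) := by
      rw [← ENNReal.ofReal_add (hη0 0).le (hη0 1).le]
      simp [η]
    have h2 : ∀ n, η (n + 1 + 1) = zetaMass s (n + 1 + 1) := fun n => by simp [η]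
    rw [h01]
    simp only [h2]
    gcongr
    exact le_add_self
  refine (entropyBits_le_lintegral (μ.map N) (fun n => (hη0 n).le) hη1 (fun n _ => hη0 n)
    hsum).trans ?_
  rw [lintegral_map (measurable_of_countable _) hNm]
  calc _ ≤ ∫⁻ ω, (ENNReal.ofReal (-Real.logb 2 (zetaMass s (max 1 (N ω)))) + 1) ∂μ := by
        refine lintegral_mono fun ω => ?_
        rcases le_or_gt (N ω) 1 with h | h
        · have h1 := neg_logb_zetaMass_nonneg hs le_rfl
          simp only [η, h, if_true, max_eq_left]
          rw [Real.logb_div (zetaMass_pos hs le_rfl).ne' two_ne_zero,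
            Real.logb_self_eq_one one_lt_two, ← ENNReal.ofReal_one,
            ← ENNReal.ofReal_add h1 one_pos.le]
          exact ENNReal.ofReal_le_ofReal (by linarith)
        · simp only [η, not_le.2 h, if_false, max_eq_right h.le]
          exact le_self_add
    _ = _ := by
        rw [lintegral_add_right _ measurable_const, lintegral_const, measure_univ, mul_one,
          zetaCodelength]

end Gibbs

/-! ### Choice of the exponent -/

section Rate

variable {I : ℝ}

lemma one_lt_zetaExponent (hI : 0 ≤ I) : 1 < zetaExponent I := by
  have : 0 < Real.logb 2 (Real.exp 1) :=
    Real.logb_pos one_lt_two (Real.one_lt_exp_iff.2 one_pos)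
  rw [zetaExponent]
  have : 0 < 1 / (I + Real.exp (-1) * Real.logb 2 (Real.exp 1) + 1) := by positivity
  linarith

/-- Only `0 < d ≤ 2` is used of the constant `d = e⁻¹ log₂ e`: the first term is below `I + 2`, and
the argument of the logarithm is `I + d + 2 ≤ 4 * (I + 1)`. -/
lemma zetaExponent_mul_add_logb_lt (hI : 0 ≤ I) :
    zetaExponent I * (I + 1) + Real.logb 2 (1 + 1 / (zetaExponent I - 1))
      < I + Real.logb 2 (I + 1) + 4 := by
  have hl : 0 < Real.logb 2 (Real.exp 1) :=
    Real.logb_pos one_lt_two (Real.one_lt_exp_iff.2 one_pos)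
  have hl2 : Real.logb 2 (Real.exp 1) ≤ 2 := by
    rw [Real.logb, Real.log_exp, div_le_iff₀ (Real.log_pos one_lt_two)]
    linarith [Real.log_two_gt_d9]
  have he : Real.exp (-1) ≤ 1 := Real.exp_le_one_iff.2 (by norm_num)
  have hd0 : 0 < Real.exp (-1) * Real.logb 2 (Real.exp 1) := by positivity
  have hd2 : Real.exp (-1) * Real.logb 2 (Real.exp 1) ≤ 2 := by nlinarith [Real.exp_pos (-1)]
  rw [zetaExponent]
  generalize Real.exp (-1) * Real.logb 2 (Real.exp 1) = d at *
  have h1 : 1 + 1 / (1 + 1 / (I + d + 1) - 1) = I + d + 2 := by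
    rw [add_sub_cancel_left, one_div_one_div]
    ring
  have h2 : (1 + 1 / (I + d + 1)) * (I + 1) < I + 2 := by
    have : (I + 1) / (I + d + 1) < 1 := (div_lt_one (by positivity)).2 (by linarith)
    have h3 : (1 + 1 / (I + d + 1)) * (I + 1) = I + 1 + (I + 1) / (I + d + 1) := by ring
    linarith
  have h4 : Real.logb 2 (I + d + 2) ≤ 2 + Real.logb 2 (I + 1) := by
    calc Real.logb 2 (I + d + 2) ≤ Real.logb 2 (2 ^ 2 * (I + 1)) :=
          Real.logb_le_logb_of_le one_lt_two (by positivity) (by nlinarith)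
      _ = _ := by
          rw [Real.logb_mul (by positivity) (by positivity), Real.logb_pow,
            Real.logb_self_eq_one one_lt_two]
          norm_num
  rw [h1]
  linarith

/-- Serves the raw loop output, where one bit goes to the extra value `0`. The entropy bound does
not mention the exponent, so it may be chosen afresh: the surplus over `I + 1` is exactly `2 / 3`,
and `log₂ (5 / 2) < 4 / 3` because `(5 / 2) ^ 3 < 2 ^ 4`. -/
lemma exists_exponent_mul_add_logb_lt (hI : 0 ≤ I) : ∃ s : ℝ, 1 < s ∧
    s * (I + 1) + Real.logb 2 (1 + 1 / (s - 1)) + 1 < I + Real.logb 2 (I + 1) + 4 := by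
  have hx : 0 < I + 1 := by positivity
  refine ⟨1 + 2 / (3 * (I + 1)), lt_add_of_pos_right _ (by positivity), ?_⟩
  have h1 : (1 + 2 / (3 * (I + 1))) * (I + 1) = I + 1 + 2 / 3 := by field_simp
  have h2 : 1 + 1 / (1 + 2 / (3 * (I + 1)) - 1) = 1 + 3 / 2 * (I + 1) := by
    rw [add_sub_cancel_left]
    field_simp
  have h3 : Real.logb 2 (5 / 2) < 4 / 3 := by
    have h := Real.logb_lt_logb one_lt_two (by norm_num) (show ((5 : ℝ) / 2) ^ 3 < 2 ^ 4 by norm_num)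
    rw [Real.logb_pow, Real.logb_pow, Real.logb_self_eq_one one_lt_two] at h
    norm_num at h
    linarith
  have h4 : Real.logb 2 (1 + 3 / 2 * (I + 1)) ≤ Real.logb 2 (5 / 2) + Real.logb 2 (I + 1) := by
    rw [← Real.logb_mul (by norm_num) hx.ne']
    exact Real.logb_le_logb_of_le one_lt_two (by positivity) (by linarith)
  rw [h1, h2]
  linarith

end Rate

/-! ### The main theorem -/

theorem mainTheorem4 {Ω 𝓧 𝓨 : Type*} [MeasurableSpace Ω] [MeasurableSpace 𝓧] [MeasurableSpace 𝓨]
    [StandardBorelSpace 𝓧] [Nonempty 𝓧]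
    (μ : Measure Ω) [IsProbabilityMeasure μ] (P : Measure 𝓧) [IsProbabilityMeasure P]
    (X : ℕ → Ω → 𝓧) (G : ℕ → Ω → ℝ) (hXG : IsSharedRandomness μ P X G)
    (k : ℕ) (hk : 1 ≤ k) :
    -- a fixed target `Q` and proposal `P`
    (∀ (Q : Measure 𝓧) (r : 𝓧 → ℝ≥0∞), IsProbabilityMeasure Q → Q ≪ P → Measurable r →
      IsUnnormalizedDensity r Q P →
      ∀ N N' : Ω → ℕ,
      (N = fun ω => aStarIndex (aStarScore r (fun i => X i ω) (fun i => G i ω))) →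
      (N' = fun ω => depthLimitedIndex (aStarScore r (fun i => X i ω) (fun i => G i ω)) k) →
      (∀ᵐ ω ∂μ, N ω ∈ argmaxSet (aStarScore r (fun i => X i ω) (fun i => G i ω)) ∧ N' ω ≤ N ω) ∧
      expLogIndex μ N' ≤ expLogIndex μ N) ∧
    -- channel simulation for a pair `(y, x)` with joint law `π`
    (∀ (π : Measure (𝓨 × 𝓧)) (y : Ω → 𝓨) (r : 𝓨 → 𝓧 → ℝ≥0∞) (_ : IsProbabilityMeasure π),
      π.snd = P → klDiv π (π.fst.prod π.snd) ≠ ∞ →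
      Measurable y → μ.map y = π.fst →
      IndepFun y (fun ω => ((fun i => X i ω : ℕ → 𝓧), (fun i => G i ω : ℕ → ℝ))) μ →
      Measurable (Function.uncurry r) →
      (∀ᵐ b ∂π.fst, IsUnnormalizedDensity (r b) (π.condKernel b) P) →
      ∀ (N N' N₀ : Ω → ℕ) (I lam : ℝ),
      (N = fun ω => aStarIndex (aStarScore (r (y ω)) (fun i => X i ω) (fun i => G i ω))) →
      (N' = fun ω =>
        depthLimitedIndex (aStarScore (r (y ω)) (fun i => X i ω) (fun i => G i ω)) k) →
      (N₀ = fun ω => loopIndex (aStarScore (r (y ω)) (fun i => X i ω) (fun i => G i ω)) k) →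
      I = mutualInfoBits π → lam = zetaExponent I →
      (∀ᵐ ω ∂μ, N ω ∈ argmaxSet (aStarScore (r (y ω)) (fun i => X i ω) (fun i => G i ω)) ∧
        N' ω ≤ N ω) ∧
      expLogIndex μ N' ≤ expLogIndex μ N ∧
      -- the entropy bound, obtained by encoding with the zeta distribution
      entropyBits (μ.map N') ≤ zetaCodelength μ lam N' ∧
      zetaCodelength μ lam N' < ENNReal.ofReal (I + Real.logb 2 (I + 1) + 4) ∧
      entropyBits (μ.map N') < ENNReal.ofReal (I + Real.logb 2 (I + 1) + 4) ∧
      entropyBits (μ.map N₀) < ENNReal.ofReal (I + Real.logb 2 (I + 1) + 4) ∧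
      -- an actual binary prefix code for the index
      ∃ c : ℕ → List Bool, IsZetaCode lam c ∧
        ∫⁻ ω, ((c (N' ω)).length : ℝ≥0∞) ∂μ
          < ENNReal.ofReal (I + Real.logb 2 (I + 1) + 5)) := by
  refine ⟨?_, ?_⟩
  · rintro Q r _ hQ hr hrQ N N' rfl rfl
    have hae : ∀ᵐ ω ∂μ, aStarIndex (aStarScore r (fun i => X i ω) (fun i => G i ω))
          ∈ argmaxSet (aStarScore r (fun i => X i ω) (fun i => G i ω)) ∧
        depthLimitedIndex (aStarScore r (fun i => X i ω) (fun i => G i ω)) k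
          ≤ aStarIndex (aStarScore r (fun i => X i ω) (fun i => G i ω)) := by
      filter_upwards [hXG.ae_exists_isMax_of_isUnnormalizedDensity hr hrQ] with ω hω
      have hmem := aStarIndex_mem hω
      exact ⟨hmem, depthLimitedIndex_le_of_mem hk hmem⟩
    exact ⟨hae, expLogIndex_mono (fun ω => one_le_depthLimitedIndex _ k)
      (hae.mono fun ω hω => hω.2)⟩
  · rintro π y r _ hπP hkl hy hyπ hind hr hrπ N N' N₀ I lam rfl hN' hN₀ hI rfl
    have hae : ∀ᵐ ω ∂μ, aStarIndex (aStarScore (r (y ω)) (fun i => X i ω) (fun i => G i ω))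
          ∈ argmaxSet (aStarScore (r (y ω)) (fun i => X i ω) (fun i => G i ω)) ∧
        N' ω ≤ aStarIndex (aStarScore (r (y ω)) (fun i => X i ω) (fun i => G i ω)) := by
      filter_upwards [hXG.ae_exists_isMax_of_indepFun hy hyπ hind hr hrπ] with ω hω
      have hmem := aStarIndex_mem hω
      rw [hN']
      exact ⟨hmem, depthLimitedIndex_le_of_mem hk hmem⟩
    have hN'1 : ∀ ω, 1 ≤ N' ω := fun ω => by
      rw [hN']
      exact one_le_depthLimitedIndex _ k
    have hI0 : 0 ≤ I := hI ▸ mutualInfoBits_nonneg π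
    have hlog : expLogIndex μ N' ≤ ENNReal.ofReal (I + 1) := by
      rw [hN', hI]
      exact hXG.expLogIndex_depthLimitedIndex_le hπP hkl hy hyπ hind hr hrπ hk
    have hscore : ∀ i, Measurable fun ω =>
        aStarScore (r (y ω)) (fun i => X i ω) (fun i => G i ω) i := fun i =>
      (measurable_aStarScore_uncurry hr i).comp (hy.prodMk hXG.measurable_randomness)
    have hN₀m : Measurable N₀ := hN₀ ▸ measurable_loopIndex hscore k
    have hN'm : Measurable N' := hN' ▸ measurable_depthLimitedIndex hscore k
    have hmax : N' = fun ω => max 1 (N₀ ω) := by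
      rw [hN', hN₀]
      rfl
    have hlI : 0 ≤ Real.logb 2 (I + 1) := Real.logb_nonneg one_lt_two (by linarith)
    have hs := one_lt_zetaExponent hI0
    have hcode : zetaCodelength μ (zetaExponent I) N'
        < ENNReal.ofReal (I + Real.logb 2 (I + 1) + 4) :=
      (zetaCodelength_le hs hN'1 (by positivity) hlog).trans_lt
        ((ENNReal.ofReal_lt_ofReal_iff (by positivity)).2 (zetaExponent_mul_add_logb_lt hI0))
    have hent := entropyBits_map_le_zetaCodelength (μ := μ) hs hN'm hN'1
    refine ⟨hae, expLogIndex_mono hN'1 (hae.mono fun ω hω => hω.2), hent, hcode,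
      hent.trans_lt hcode, ?_, ?_⟩
    · obtain ⟨s, hs1, hlt⟩ := exists_exponent_mul_add_logb_lt hI0
      have hnn : 0 ≤ s * (I + 1) + Real.logb 2 (1 + 1 / (s - 1)) := by
        have h1 : 0 ≤ 1 / (s - 1) := one_div_nonneg.2 (by linarith)
        have h2 : 0 ≤ Real.logb 2 (1 + 1 / (s - 1)) :=
          Real.logb_nonneg one_lt_two (by linarith)
        have h3 : 0 ≤ s * (I + 1) := mul_nonneg (by linarith) (by linarith)
        linarith
      calc entropyBits (μ.map N₀) ≤ zetaCodelength μ s N' + 1 := by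
            rw [hmax]
            exact entropyBits_map_le_zetaCodelength_max hs1 hN₀m
        _ ≤ ENNReal.ofReal (s * (I + 1) + Real.logb 2 (1 + 1 / (s - 1))) + 1 := by
            gcongr
            exact zetaCodelength_le hs1 hN'1 (by positivity) hlog
        _ = ENNReal.ofReal (s * (I + 1) + Real.logb 2 (1 + 1 / (s - 1)) + 1) := by
            rw [ENNReal.ofReal_add hnn one_pos.le, ENNReal.ofReal_one]
        _ < _ := (ENNReal.ofReal_lt_ofReal_iff (by positivity)).2 hlt
    · obtain ⟨c, hc⟩ := exists_isZetaCode hs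
      refine ⟨c, hc, (lintegral_length_le hs hc hN'1).trans_lt ?_⟩
      have h5 : ENNReal.ofReal (I + Real.logb 2 (I + 1) + 5)
          = ENNReal.ofReal (I + Real.logb 2 (I + 1) + 4) + 1 := by
        rw [← ENNReal.ofReal_one, ← ENNReal.ofReal_add (by positivity) one_pos.le]
        congr 1
        ring
      rw [h5]
      exact ENNReal.add_lt_add_right ENNReal.one_ne_top hcode
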